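/- All rigs below are commutative rigs (commutative semirings) and all rings are commutative rings, with unit-preserving homomorphisms. **Partial maps.** A stable system of monics $\mathcal M$ in a category $\mathbb X$ is a class of monics that contains all isomorphisms, is closed under composition, and such that the pullback of any $m\in\mathcal M$ along any map exists and lies in $\mathcal M$. The category $\mathsf{Par}(\mathbb X,\mathcal M)$ has the objects of $\mathbb X$; a map $A\to B$ is an isomorphism class of spans $A\xleftarrow{m}A'\xrightarrow{f}B$ with $m\in\mathcal M$; composition is by pullback; the restriction of $(m,f)$ is $(m,m)$. **Weak and fractional rigs.** A weak commutative rig is a set with two commutative monoid structures $(+,0)$ and $(\cdot,1)$ such that $x(y+z)=xy+xz$, $0\cdot 0=0$ and $0x=0xx$. Homomorphisms preserve $0,1,+,\cdot$; $\mathbf{wCRig}$ is the resulting category and $W:\mathbf{CRig}\to\mathbf{wCRig}$ is the inclusion of commutative rigs. A fractional rig is a weak commutative rig with an operation $(\_)^*$ such that $1^*=1$, $x^{***}=x^*$, $(xy)^*=y^*x^*$, $x^*xx^*=x^*$ and $x^*x(y+z)=x^*xy+z$; homomorphisms also preserve $(\_)^*$, giving the category $\mathbf{fwCRig}$. For a weak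 commutative rig $R$, $\mathfrak{fr}(R)$ is the quotient of $R\times R$ by the equivalence relation generated by $(r,as)\sim(ar,a^2s)$, with $(r,s)+(r',s')=(rs'+sr',ss')$, $(r,s)(r',s')=(rr',ss')$, $0=(0,1)$, $1=(1,1)$ and $(x,y)^*=(y^2,yx)$; this is a fractional rig, functorially in $R$ via $(x,y)\mapsto(f(x),f(y))$. **Localizations.** In $\mathbf{fwCRig}$, $\mathrm{loc}$ is the class of maps out of $R$ that are universal among maps sending $e$ to $1$, for some $e\in R$ with $ee=e=e^*$. In $\mathbf{CRig}$ (respectively $\mathbf{CRing}$), $\mathrm{Loc}$ is the class of homomorphisms out of $R$ that are universal, in that category, among homomorphisms sending every element of $U$ to a unit, for some finitely generated multiplicative subset (submonoid) $U\subseteq R$. These classes are stable systems of monics in $\mathbf{fwCRig}^{\rm op}$, $\mathbf{CRig}^{\rm op}$ and $\mathbf{CRing}^{\rm op}$. Put $\mathbf{RAT}=\mathsf{Par}(\mathbf{fwCRig}^{\rm op},\mathrm{loc})$, $\mathbf{RAT}_{\sf rig}=\mathsf{Par}(\mathbf{CRig}^{\rm op},\mathrm{Loc})$ and $\mathbf{RAT}_{\sf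 ring}=\mathsf{Par}(\mathbf{CRing}^{\rm op},\mathrm{Loc})$. **Theorem.** The functor $R\mapsto\mathfrak{fr}(W(R))$ sends finitely generated localizations of commutative rigs to localizations of fractional rigs and preserves pushouts along them. The functor that it induces by application to both legs of cospans, $$\mathbf{RAT}_{\sf rig}\to\mathbf{RAT},\qquad (R\xrightarrow{l}R'\xleftarrow{h}S)\mapsto(\mathfrak{fr}(W(R))\to\mathfrak{fr}(W(R'))\leftarrow\mathfrak{fr}(W(S))),$$ preserves restrictions and is an equivalence of $\mathbf{RAT}_{\sf rig}$ with the full subcategory of $\mathbf{RAT}$ on the objects $\mathfrak{fr}(W(R))$, $R$ a commutative rig. Likewise, with commutative rings in place of commutative rigs, the induced functor is a restriction-preserving equivalence of $\mathbf{RAT}_{\sf ring}$ with the full subcategory of $\mathbf{RAT}$ on the objects $\mathfrak{fr}(W(R))$, $R$ a commutative ring. -/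

import Mathlib

universe u v u' v'

open CategoryTheory

namespace PartialMaps

/-- A stable system of monics: a class of monics that contains all isomorphisms, is closed under
composition, and along which pullbacks of arbitrary maps exist and stay in the class. -/
class StableSystemOfMonics {C : Type u} [Category.{v} C] (M : MorphismProperty C) : Prop where
  mono_of_mem : ∀ {A B : C} (m : A ⟶ B), M m → Mono m
  mem_of_isIso : ∀ {A B : C} (m : A ⟶ B), IsIso m → M m
  comp_mem : ∀ {A B D : C} (m : A ⟶ B) (n : B ⟶ D), M m → M n → M (m ≫ n)
  exists_pullback : ∀ {A B B' : C} (m : B' ⟶ B) (f : A ⟶ B), M m →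
    ∃ (A' : C) (f' : A' ⟶ B') (m' : A' ⟶ A), IsPullback f' m' m f ∧ M m'

/-- A span `A ⟵ A' ⟶ B` whose left leg lies in `M`. -/
structure PSpan {C : Type u} [Category.{v} C] (M : MorphismProperty C) (A B : C) where
  apex : C
  left : apex ⟶ A
  right : apex ⟶ B
  mem : M left

/-- Two spans are identified when an isomorphism of the apexes commutes with both legs. -/
def PSpan.setoid {C : Type u} [Category.{v} C] (M : MorphismProperty C) (A B : C) :
    Setoid (PSpan M A B) where
  r s t := ∃ φ : s.apex ≅ t.apex, φ.hom ≫ t.left = s.left ∧ φ.hom ≫ t.right = s.right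
  iseqv :=
    { refl := fun s => ⟨Iso.refl _, by simp, by simp⟩
      symm := by
        rintro s t ⟨φ, h₁, h₂⟩
        exact ⟨φ.symm, by simp [← h₁], by simp [← h₂]⟩
      trans := by
        rintro s t r ⟨φ, h₁, h₂⟩ ⟨ψ, h₃, h₄⟩
        exact ⟨φ ≪≫ ψ, by simp [h₁, h₃], by simp [h₂, h₄]⟩ }

/-- A partial map `A ⟶ B`: an isomorphism class of spans with left leg in `M`. -/
def PHom {C : Type u} [Category.{v} C] (M : MorphismProperty C) (A B : C) :=
  Quotient (PSpan.setoid M A B)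

/-- The partial map represented by a span. -/
def PSpan.toPHom {C : Type u} [Category.{v} C] {M : MorphismProperty C} {A B : C}
    (s : PSpan M A B) : PHom M A B :=
  Quotient.mk (PSpan.setoid M A B) s

theorem PSpan.toPHom_eq {C : Type u} [Category.{v} C] {M : MorphismProperty C} {A B : C}
    {s t : PSpan M A B} (φ : s.apex ≅ t.apex) (h₁ : φ.hom ≫ t.left = s.left)
    (h₂ : φ.hom ≫ t.right = s.right) : s.toPHom = t.toPHom :=
  Quotient.sound ⟨φ, h₁, h₂⟩

/-- The composite of two spans, formed with a chosen pullback. -/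
noncomputable def PSpan.comp {C : Type u} [Category.{v} C]
    {M : MorphismProperty C} [hM : StableSystemOfMonics M] {A B D : C}
    (s : PSpan M A B) (t : PSpan M B D) : PSpan M A D where
  apex := (hM.exists_pullback t.left s.right t.mem).choose
  left := (hM.exists_pullback t.left s.right t.mem).choose_spec.choose_spec.choose ≫ s.left
  right := (hM.exists_pullback t.left s.right t.mem).choose_spec.choose ≫ t.right
  mem := hM.comp_mem _ _
    (hM.exists_pullback t.left s.right t.mem).choose_spec.choose_spec.choose_spec.2 s.mem

/-- The chosen composite agrees with the one formed by any other pullback. -/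
theorem PSpan.comp_toPHom_eq {C : Type u} [Category.{v} C]
    {M : MorphismProperty C} [hM : StableSystemOfMonics M] {A B D : C}
    (s : PSpan M A B) (t : PSpan M B D) (r : PSpan M A D)
    (p : r.apex ⟶ t.apex) (q : r.apex ⟶ s.apex) (h : IsPullback p q t.left s.right)
    (hl : q ≫ s.left = r.left) (hr : p ≫ t.right = r.right) :
    (s.comp t).toPHom = r.toPHom := by
  have h' := (hM.exists_pullback t.left s.right t.mem).choose_spec.choose_spec.choose_spec.1
  refine PSpan.toPHom_eq (h'.isoIsPullback _ _ h) ?_ ?_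
  · rw [← hl]
    exact IsPullback.isoIsPullback_hom_snd_assoc _ _ h' h s.left
  · rw [← hr]
    exact IsPullback.isoIsPullback_hom_fst_assoc _ _ h' h t.right

/-- Composition of partial maps, by pullback of representatives. -/
noncomputable def PHom.comp {C : Type u} [Category.{v} C]
    {M : MorphismProperty C} [hM : StableSystemOfMonics M] {A B D : C}
    (f : PHom M A B) (g : PHom M B D) : PHom M A D :=
  Quotient.liftOn₂ f g (fun s t => (s.comp t).toPHom) (by
    rintro s t s' t' ⟨φ, h₁, h₂⟩ ⟨ψ, h₃, h₄⟩
    have h := (hM.exists_pullback t'.left s'.right t'.mem).choose_spec.choose_spec.choose_spec.1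
    refine PSpan.comp_toPHom_eq s t (s'.comp t')
      ((hM.exists_pullback t'.left s'.right t'.mem).choose_spec.choose ≫ ψ.inv)
      ((hM.exists_pullback t'.left s'.right t'.mem).choose_spec.choose_spec.choose ≫ φ.inv)
      (h.of_iso (Iso.refl _) ψ.symm φ.symm (Iso.refl _) (Category.id_comp _).symm
        (Category.id_comp _).symm (by simp [← h₃])
        (by simp [← h₂])) ?_ ?_
    · simp [← h₁, PSpan.comp]
    · simp [← h₄, PSpan.comp])

theorem PHom.comp_eq {C : Type u} [Category.{v} C]
    {M : MorphismProperty C} [hM : StableSystemOfMonics M] {A B D : C}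
    (s : PSpan M A B) (t : PSpan M B D) (r : PSpan M A D)
    (p : r.apex ⟶ t.apex) (q : r.apex ⟶ s.apex) (h : IsPullback p q t.left s.right)
    (hl : q ≫ s.left = r.left) (hr : p ≫ t.right = r.right) :
    PHom.comp s.toPHom t.toPHom = r.toPHom :=
  PSpan.comp_toPHom_eq s t r p q h hl hr

/-- The objects of the partial map category are the objects of `C`. -/
structure Par {C : Type u} [Category.{v} C] (M : MorphismProperty C) where
  base : C

/-- The category `Par(C, M)` of partial maps: objects of `C`, isomorphism classes of spans with
left leg in `M`, composition by pullback. -/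
noncomputable instance Par.category {C : Type u} [Category.{v} C]
    (M : MorphismProperty C) [hM : StableSystemOfMonics M] : Category.{max u v} (Par M) where
  Hom A B := PHom M A.base B.base
  id A := PSpan.toPHom ⟨A.base, 𝟙 _, 𝟙 _, hM.mem_of_isIso _ inferInstance⟩
  comp f g := PHom.comp f g
  id_comp := by
    intro A B f
    obtain ⟨s, rfl⟩ := Quotient.exists_rep f
    exact PHom.comp_eq _ s s (𝟙 _) s.left (IsPullback.id_horiz _) (by simp) (by simp)
  comp_id := by
    intro A B f
    obtain ⟨s, rfl⟩ := Quotient.exists_rep f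
    exact PHom.comp_eq s _ s s.right (𝟙 _) (IsPullback.id_vert _) (by simp) (by simp)
  assoc := by
    intro A B D E f g h
    obtain ⟨s, rfl⟩ := Quotient.exists_rep f
    obtain ⟨t, rfl⟩ := Quotient.exists_rep g
    obtain ⟨r, rfl⟩ := Quotient.exists_rep h
    obtain ⟨P, p, q, hP, hq⟩ := hM.exists_pullback t.left s.right t.mem
    obtain ⟨Q, p', q', hQ, hq'⟩ := hM.exists_pullback r.left t.right r.mem
    obtain ⟨T, a, b, hT, hb⟩ := hM.exists_pullback q' p hq'
    have e₁ : PHom.comp s.toPHom t.toPHom =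
        PSpan.toPHom ⟨P, q ≫ s.left, p ≫ t.right, hM.comp_mem _ _ hq s.mem⟩ :=
      PHom.comp_eq s t ⟨P, q ≫ s.left, p ≫ t.right, hM.comp_mem _ _ hq s.mem⟩ p q hP rfl rfl
    have e₂ : PHom.comp t.toPHom r.toPHom =
        PSpan.toPHom ⟨Q, q' ≫ t.left, p' ≫ r.right, hM.comp_mem _ _ hq' t.mem⟩ :=
      PHom.comp_eq t r ⟨Q, q' ≫ t.left, p' ≫ r.right, hM.comp_mem _ _ hq' t.mem⟩ p' q' hQ rfl rfl
    change PHom.comp (PHom.comp s.toPHom t.toPHom) r.toPHom =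
      PHom.comp s.toPHom (PHom.comp t.toPHom r.toPHom)
    rw [e₁, e₂]
    have hbq : M ((b ≫ q) ≫ s.left) := hM.comp_mem _ _ (hM.comp_mem _ _ hb hq) s.mem
    rw [PHom.comp_eq (⟨P, q ≫ s.left, p ≫ t.right, _⟩ : PSpan M _ _) r
        ⟨T, (b ≫ q) ≫ s.left, (a ≫ p') ≫ r.right, hbq⟩ (a ≫ p') b
        (hT.flip.paste_vert hQ.flip).flip (by simp) rfl]
    rw [PHom.comp_eq s (⟨Q, q' ≫ t.left, p' ≫ r.right, _⟩ : PSpan M _ _)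
        ⟨T, (b ≫ q) ≫ s.left, (a ≫ p') ≫ r.right, hbq⟩ a (b ≫ q)
        (hT.paste_vert hP) rfl (by simp)]

/-- The restriction of the partial map `(m, f)` is the partial map `(m, m)`. -/
def Par.restriction {C : Type u} [Category.{v} C] {M : MorphismProperty C}
    [StableSystemOfMonics M] {A B : Par M} (f : A ⟶ B) : A ⟶ A :=
  Quotient.liftOn (s := PSpan.setoid M A.base B.base) f
    (fun s => PSpan.toPHom ⟨s.apex, s.left, s.left, s.mem⟩) (by
      rintro s t ⟨φ, h₁, -⟩
      exact PSpan.toPHom_eq φ h₁ h₁)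

/-- A functor between categories with stable systems of monics that preserves the monics of the
systems and the pullbacks along them. -/
structure IsMFunctor {C : Type u} [Category.{v} C] {D : Type u'} [Category.{v'} D]
    (G : C ⥤ D) (M : MorphismProperty C) (N : MorphismProperty D) : Prop where
  map_mem : ∀ {A B : C} (m : A ⟶ B), M m → N (G.map m)
  map_isPullback : ∀ {A B A' B' : C} (f' : A' ⟶ B') (m' : A' ⟶ A) (m : B' ⟶ B) (f : A ⟶ B),
    M m → IsPullback f' m' m f → IsPullback (G.map f') (G.map m') (G.map m) (G.map f)

/-- The functor between partial map categories which applies such a functor to objects and to both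
legs of spans. -/
def IsMFunctor.par {C : Type u} [Category.{v} C] {D : Type u'} [Category.{v'} D]
    {G : C ⥤ D} {M : MorphismProperty C} {N : MorphismProperty D} [hM : StableSystemOfMonics M]
    [hN : StableSystemOfMonics N] (h : IsMFunctor G M N) : Par M ⥤ Par N where
  obj A := ⟨G.obj A.base⟩
  map {A B} f := Quotient.liftOn (s := PSpan.setoid M A.base B.base) f
    (fun s => PSpan.toPHom ⟨G.obj s.apex, G.map s.left, G.map s.right, h.map_mem _ s.mem⟩) (by
      rintro s t ⟨φ, h₁, h₂⟩
      exact PSpan.toPHom_eq (G.mapIso φ) (by simp [← h₁]) (by simp [← h₂]))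
  map_id A := PSpan.toPHom_eq (Iso.refl _) (by simp) (by simp)
  map_comp {A B D} f g := by
    obtain ⟨s, rfl⟩ := Quotient.exists_rep f
    obtain ⟨t, rfl⟩ := Quotient.exists_rep g
    obtain ⟨P, p, q, hP, hq⟩ := hM.exists_pullback t.left s.right t.mem
    have e : PHom.comp s.toPHom t.toPHom =
        PSpan.toPHom ⟨P, q ≫ s.left, p ≫ t.right, hM.comp_mem _ _ hq s.mem⟩ :=
      PHom.comp_eq s t ⟨P, q ≫ s.left, p ≫ t.right, hM.comp_mem _ _ hq s.mem⟩ p q hP rfl rfl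
    change Quotient.liftOn (s := PSpan.setoid M A.base D.base)
      (PHom.comp s.toPHom t.toPHom) _ _ = _
    rw [e]
    refine (PHom.comp_eq _ _ _ (G.map p) (G.map q) (h.map_isPullback _ _ _ _ t.mem hP)
      ?_ ?_).symm <;> simp

end PartialMaps

namespace Rational

/-- A weak commutative rig: two commutative monoid structures with binary distributivity,
`0 * 0 = 0` and `0 * x = 0 * x * x`; it is not required that `0 * x = 0`. -/
class WeakCommRig (R : Type u) extends AddCommMonoid R, CommMonoid R, Distrib R where
  zero_mul_zero' : (0 : R) * 0 = 0
  zero_mul_sq' : ∀ x : R, (0 : R) * x = 0 * x * x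

/-- Homomorphisms of weak commutative rigs preserve `0`, `1`, `+` and `*`. -/
@[ext]
structure WeakRigHom (R S : Type u) [WeakCommRig R] [WeakCommRig S] where
  toFun : R → S
  map_zero : toFun 0 = 0
  map_one : toFun 1 = 1
  map_add : ∀ x y, toFun (x + y) = toFun x + toFun y
  map_mul : ∀ x y, toFun (x * y) = toFun x * toFun y

/-- A fractional rig: a weak commutative rig with a star operation `fstar`. -/
class FractionalRig (R : Type u) extends WeakCommRig R where
  fstar : R → R
  fstar_one : fstar 1 = 1
  fstar_fstar_fstar : ∀ x, fstar (fstar (fstar x)) = fstar x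
  fstar_mul : ∀ x y, fstar (x * y) = fstar y * fstar x
  fstar_mul_self_mul_fstar : ∀ x, fstar x * x * fstar x = fstar x
  fstar_mul_add : ∀ x y z, fstar x * x * (y + z) = fstar x * x * y + z

open FractionalRig (fstar)

/-- Homomorphisms of fractional rigs also preserve the star operation. -/
@[ext]
structure FractionalRigHom (R S : Type u) [FractionalRig R] [FractionalRig S]
    extends WeakRigHom R S where
  map_fstar : ∀ x, toFun (fstar x) = fstar (toFun x)

/-- The category of weak commutative rigs. -/
structure WCRig where
  carrier : Type u
  [str : WeakCommRig carrier]

attribute [instance] WCRig.str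

instance WCRig.category : Category.{u} WCRig.{u} where
  Hom R S := WeakRigHom R.carrier S.carrier
  id R := ⟨id, rfl, rfl, fun _ _ => rfl, fun _ _ => rfl⟩
  comp f g := ⟨fun x => g.toFun (f.toFun x), by simp [f.map_zero, g.map_zero],
    by simp [f.map_one, g.map_one], by simp [f.map_add, g.map_add], by simp [f.map_mul, g.map_mul]⟩

/-- The category of fractional rigs. -/
structure FWCRig where
  carrier : Type u
  [str : FractionalRig carrier]

attribute [instance] FWCRig.str

instance FWCRig.category : Category.{u} FWCRig.{u} where
  Hom R S := FractionalRigHom R.carrier S.carrier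
  id R := ⟨⟨id, rfl, rfl, fun _ _ => rfl, fun _ _ => rfl⟩, fun _ => rfl⟩
  comp f g := ⟨⟨fun x => g.toFun (f.toFun x), by simp [f.map_zero, g.map_zero],
    by simp [f.map_one, g.map_one], by simp [f.map_add, g.map_add], by simp [f.map_mul, g.map_mul]⟩,
    by simp [f.map_fstar, g.map_fstar]⟩

theorem FWCRig.hom_ext {R S : FWCRig.{u}} {f g : R ⟶ S} (h : ∀ x, f.toFun x = g.toFun x) :
    f = g :=
  FractionalRigHom.ext (funext h)

theorem FWCRig.comp_toFun {R S T : FWCRig.{u}} (f : R ⟶ S) (g : S ⟶ T) (x : R.carrier) :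
    (f ≫ g).toFun x = g.toFun (f.toFun x) := rfl

theorem FWCRig.id_toFun {R : FWCRig.{u}} (x : R.carrier) : (𝟙 R : R ⟶ R).toFun x = x := rfl

/-! ### Fractions -/

/-- The generating relation `(r, a s) ∼ (a r, a² s)` between formal fractions. -/
inductive FracRel (R : Type u) [WeakCommRig R] : R × R → R × R → Prop
  | expand (r a s : R) : FracRel R (r, a * s) (a * r, a * a * s)

/-- The fractions of a weak commutative rig: pairs modulo the equivalence relation generated by
`FracRel`. -/
def Frac (R : Type u) [WeakCommRig R] : Type u := Quot (FracRel R)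

namespace Frac

variable {R : Type u} [WeakCommRig R]

/-- The fraction with numerator `x` and denominator `y`. -/
def mk (x y : R) : Frac R := Quot.mk _ (x, y)

theorem ind {p : Frac R → Prop} (h : ∀ x y, p (mk x y)) (z : Frac R) : p z :=
  Quot.ind (fun ⟨x, y⟩ => h x y) z

theorem mk_mul (r a s : R) : mk (a * r) (a * (a * s)) = mk r (a * s) := by
  rw [← mul_assoc]; exact (Quot.sound (FracRel.expand r a s)).symm

/-- Cancellation of a factor which also divides the remaining denominator. -/
theorem mk_eq_of_dvd {x y x' y' : R} (a s : R) (h₁ : x' = a * x) (h₂ : y = a * s)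
    (h₃ : y' = a * y) : mk x' y' = mk x y := by
  subst h₁ h₂ h₃; exact mk_mul x a s

def lift {α : Sort*} (f : R → R → α) (h : ∀ r a s, f r (a * s) = f (a * r) (a * (a * s))) :
    Frac R → α :=
  Quot.lift (fun p => f p.1 p.2) (by rintro _ _ ⟨r, a, s⟩; simpa only [mul_assoc] using h r a s)

def lift₂ {α : Sort*} (f : R → R → R → R → α)
    (h : ∀ r a s x y, f r (a * s) x y = f (a * r) (a * (a * s)) x y)
    (h' : ∀ x y r a s, f x y r (a * s) = f x y (a * r) (a * (a * s))) :
    Frac R → Frac R → α :=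
  Quot.lift₂ (fun p q => f p.1 p.2 q.1 q.2)
    (by rintro p _ _ ⟨r, a, s⟩; simpa only [mul_assoc] using h' p.1 p.2 r a s)
    (by rintro _ _ q ⟨r, a, s⟩; simpa only [mul_assoc] using h r a s q.1 q.2)

/-- `(r, s) + (r', s') = (r s' + s r', s s')`. -/
instance : Add (Frac R) :=
  ⟨lift₂ (fun r s r' s' => mk (r * s' + s * r') (s * s'))
    (fun r a s x y => (mk_eq_of_dvd a (s * y) (by simp only [mul_add]; ac_rfl) (by ac_rfl)
      (by ac_rfl)).symm)
    (fun x y r a s => (mk_eq_of_dvd a (s * y) (by simp only [mul_add]; ac_rfl) (by ac_rfl)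
      (by ac_rfl)).symm)⟩

/-- `(r, s) * (r', s') = (r r', s s')`. -/
instance : Mul (Frac R) :=
  ⟨lift₂ (fun r s r' s' => mk (r * r') (s * s'))
    (fun r a s x y => (mk_eq_of_dvd a (s * y) (by ac_rfl) (by ac_rfl) (by ac_rfl)).symm)
    (fun x y r a s => (mk_eq_of_dvd a (s * y) (by ac_rfl) (by ac_rfl) (by ac_rfl)).symm)⟩

instance : Zero (Frac R) := ⟨mk 0 1⟩

instance : One (Frac R) := ⟨mk 1 1⟩

theorem mk_add_mk (r s r' s' : R) : mk r s + mk r' s' = mk (r * s' + s * r') (s * s') := rfl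

theorem mk_mul_mk (r s r' s' : R) : mk r s * mk r' s' = mk (r * r') (s * s') := rfl

theorem zero_def : (0 : Frac R) = mk 0 1 := rfl

theorem one_def : (1 : Frac R) = mk 1 1 := rfl

theorem add_comm' (x y : Frac R) : x + y = y + x := by
  induction x using ind
  induction y using ind
  simp only [mk_add_mk]
  congr 1
  · rw [add_comm]; congr 1 <;> exact mul_comm _ _
  · exact mul_comm _ _

theorem zero_add' (x : Frac R) : 0 + x = x := by
  induction x using ind with | _ a b
  rw [zero_def, mk_add_mk]
  have h : mk (b * (0 * b + 1 * a)) (b * (1 * b)) = mk (0 * b + 1 * a) (1 * b) :=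
    mk_eq_of_dvd b 1 rfl (by simp) rfl
  rw [← h]
  refine mk_eq_of_dvd b 1 ?_ (by simp) (by simp)
  have h0 : b * (0 * b) = b * 0 := by
    rw [mul_comm b, mul_comm b]; exact (WeakCommRig.zero_mul_sq' b).symm
  rw [mul_add, h0, ← mul_add, one_mul, zero_add]

theorem left_distrib' (x y z : Frac R) : x * (y + z) = x * y + x * z := by
  induction x using ind with | _ a b
  induction y using ind with | _ c d
  induction z using ind with | _ e f
  simp only [mk_add_mk, mk_mul_mk]
  exact (mk_eq_of_dvd b (d * f) (by simp only [mul_add]; congr 1 <;> ac_rfl) rfl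
    (by ac_rfl)).symm

instance : WeakCommRig (Frac R) where
  add_assoc x y z := by
    induction x using ind
    induction y using ind
    induction z using ind
    simp only [mk_add_mk, mul_add, add_mul]
    congr 1
    · rw [add_assoc]; congr 1
      · ac_rfl
      · congr 1 <;> ac_rfl
    · ac_rfl
  zero_add := zero_add'
  add_zero x := by rw [add_comm', zero_add']
  add_comm := add_comm'
  nsmul := nsmulRec
  mul_assoc x y z := by
    induction x using ind
    induction y using ind
    induction z using ind
    simp only [mk_mul_mk, mul_assoc]
  one_mul x := by
    induction x using ind
    simp only [one_def, mk_mul_mk, one_mul]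
  mul_one x := by
    induction x using ind
    simp only [one_def, mk_mul_mk, mul_one]
  mul_comm x y := by
    induction x using ind
    induction y using ind
    simp only [mk_mul_mk]
    congr 1 <;> exact mul_comm _ _
  left_distrib := left_distrib'
  right_distrib x y z := by
    have hc : ∀ a b : Frac R, a * b = b * a := by
      intro a b
      induction a using ind
      induction b using ind
      simp only [mk_mul_mk]
      congr 1 <;> exact mul_comm _ _
    rw [hc, left_distrib', hc z x, hc z y]
  zero_mul_zero' := by
    simp only [zero_def, mk_mul_mk, WeakCommRig.zero_mul_zero', mul_one]
  zero_mul_sq' x := by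
    induction x using ind with | _ a b
    simp only [zero_def, mk_mul_mk, one_mul]
    rw [← WeakCommRig.zero_mul_sq']
    have h0 : b * (0 * a) = b * (b * (0 * a)) := by
      calc b * (0 * a) = 0 * b * a := by ac_rfl
        _ = 0 * b * b * a := by rw [← WeakCommRig.zero_mul_sq']
        _ = b * (b * (0 * a)) := by ac_rfl
    have h₁ : mk (b * (0 * a)) (b * b) = mk (0 * a) b := mk_eq_of_dvd b 1 rfl (by simp) rfl
    have h₂ : mk (b * (b * (0 * a))) (b * (b * b)) = mk (b * (0 * a)) (b * b) :=
      mk_eq_of_dvd b b rfl rfl rfl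
    have h₃ : mk (b * (0 * a)) (b * (b * b)) = mk (0 * a) (b * b) :=
      mk_eq_of_dvd b b rfl rfl rfl
    rw [← h₁, ← h₂, ← h₃, ← h0]

/-- `(x, y)* = (y², y x)`. -/
def star : Frac R → Frac R :=
  lift (fun x y => mk (y * y) (y * x)) (fun r a s => by
    have h₁ : mk (a * ((a * s) * (a * s))) (a * ((a * s) * r)) = mk ((a * s) * (a * s)) ((a * s) * r) :=
      mk_eq_of_dvd a (s * r) rfl (by ac_rfl) rfl
    have h₂ : mk (a * (a * ((a * s) * (a * s)))) (a * (a * ((a * s) * r))) =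
        mk (a * ((a * s) * (a * s))) (a * ((a * s) * r)) :=
      mk_eq_of_dvd a (a * s * r) rfl rfl rfl
    rw [← h₁, ← h₂]
    congr 1 <;> ac_rfl)

theorem star_mk (x y : R) : star (mk x y) = mk (y * y) (y * x) := rfl

instance : FractionalRig (Frac R) where
  fstar := star
  fstar_one := by simp [one_def, star_mk]
  fstar_fstar_fstar z := by
    induction z using ind with | _ x y
    simp only [star_mk]
    have h₁ : mk (x * (y * y)) (x * (y * x)) = mk (y * y) (y * x) :=
      mk_eq_of_dvd x y rfl (by ac_rfl) rfl
    have h₂ : mk (x * (x * (y * y))) (x * (x * (y * x))) = mk (x * (y * y)) (x * (y * x)) :=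
      mk_eq_of_dvd x (y * x) rfl rfl rfl
    have h₃ : mk (y * (x * (x * (y * y)))) (y * (x * (x * (y * x)))) =
        mk (x * (x * (y * y))) (x * (x * (y * x))) :=
      mk_eq_of_dvd y (x * (x * x)) rfl (by ac_rfl) rfl
    have h₄ : mk (y * (y * (x * (x * (y * y))))) (y * (y * (x * (x * (y * x))))) =
        mk (y * (x * (x * (y * y)))) (y * (x * (x * (y * x)))) :=
      mk_eq_of_dvd y (x * (x * (y * x))) rfl rfl rfl
    have h₅ : mk (y * (y * (y * (x * (x * (y * y)))))) (y * (y * (y * (x * (x * (y * x)))))) =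
        mk (y * (y * (x * (x * (y * y))))) (y * (y * (x * (x * (y * x))))) :=
      mk_eq_of_dvd y (y * (x * (x * (y * x)))) rfl rfl rfl
    have h₆ : mk (y * (y * (y * (y * (x * (x * (y * y)))))))
        (y * (y * (y * (y * (x * (x * (y * x))))))) =
        mk (y * (y * (y * (x * (x * (y * y)))))) (y * (y * (y * (x * (x * (y * x)))))) :=
      mk_eq_of_dvd y (y * (y * (x * (x * (y * x))))) rfl rfl rfl
    rw [← h₁, ← h₂, ← h₃, ← h₄, ← h₅, ← h₆]
    congr 1 <;> ac_rfl
  fstar_mul z w := by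
    induction z using ind
    induction w using ind
    simp only [star_mk, mk_mul_mk]
    congr 1 <;> ac_rfl
  fstar_mul_self_mul_fstar z := by
    induction z using ind with | _ x y
    simp only [star_mk, mk_mul_mk]
    have h₁ : mk (x * (y * y)) (x * (y * x)) = mk (y * y) (y * x) :=
      mk_eq_of_dvd x y rfl (by ac_rfl) rfl
    have h₂ : mk (y * (x * (y * y))) (y * (x * (y * x))) = mk (x * (y * y)) (x * (y * x)) :=
      mk_eq_of_dvd y (x * x) rfl (by ac_rfl) rfl
    have h₃ : mk (y * (y * (x * (y * y)))) (y * (y * (x * (y * x)))) =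
        mk (y * (x * (y * y))) (y * (x * (y * x))) :=
      mk_eq_of_dvd y (x * (y * x)) rfl rfl rfl
    rw [← h₁, ← h₂, ← h₃]
    congr 1 <;> ac_rfl
  fstar_mul_add z w v := by
    induction z using ind with | _ x y
    induction w using ind with | _ p q
    induction v using ind with | _ r s
    simp only [star_mk, mk_mul_mk, mk_add_mk, mul_add]
    congr 1
    · congr 1 <;> ac_rfl
    · ac_rfl

theorem fstar_mk (x y : R) : fstar (mk x y) = mk (y * y) (y * x) := rfl

/-- `(x, y) ↦ (f x, f y)`. -/
def map {S : Type u} [WeakCommRig S] (f : WeakRigHom R S) : FractionalRigHom (Frac R) (Frac S) where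
  toFun := lift (fun x y => mk (f.toFun x) (f.toFun y))
    (fun r a s => by simp only [f.map_mul]; exact (mk_mul _ _ _).symm)
  map_zero := by
    change mk (f.toFun 0) (f.toFun 1) = mk 0 1
    rw [f.map_zero, f.map_one]
  map_one := by
    change mk (f.toFun 1) (f.toFun 1) = mk 1 1
    rw [f.map_one]
  map_add z w := by
    induction z using ind with | _ x y
    induction w using ind with | _ p q
    change mk (f.toFun (x * q + y * p)) (f.toFun (y * q)) = _
    simp only [f.map_add, f.map_mul]
    rfl
  map_mul z w := by
    induction z using ind with | _ x y
    induction w using ind with | _ p q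
    change mk (f.toFun (x * p)) (f.toFun (y * q)) = _
    simp only [f.map_mul]
    rfl
  map_fstar z := by
    induction z using ind with | _ x y
    change mk (f.toFun (y * y)) (f.toFun (y * x)) = _
    simp only [f.map_mul]
    rfl

theorem map_mk {S : Type u} [WeakCommRig S] (f : WeakRigHom R S) (x y : R) :
    (map f).toFun (mk x y) = mk (f.toFun x) (f.toFun y) := rfl

end Frac

/-- The functor of fractions, from weak commutative rigs to fractional rigs. -/
def fr : WCRig.{u} ⥤ FWCRig.{u} where
  obj R := ⟨Frac R.carrier⟩
  map f := Frac.map f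
  map_id R := FWCRig.hom_ext (R := ⟨Frac R.carrier⟩) (S := ⟨Frac R.carrier⟩)
    (Frac.ind (fun _ _ => rfl))
  map_comp {R _ T} _ _ := FWCRig.hom_ext (R := ⟨Frac R.carrier⟩) (S := ⟨Frac T.carrier⟩)
    (Frac.ind (fun _ _ => rfl))

/-- A commutative rig, regarded as a weak commutative rig. -/
abbrev weakCommRigOfCommSemiring (R : Type u) [CommSemiring R] : WeakCommRig R :=
  { (inferInstance : CommSemiring R) with
    zero_mul_zero' := zero_mul 0
    zero_mul_sq' := fun x => by simp }

/-- The inclusion of commutative rigs into weak commutative rigs. -/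
def W : CommSemiRingCat.{u} ⥤ WCRig.{u} where
  obj R := @WCRig.mk R (weakCommRigOfCommSemiring R)
  map f := @WeakRigHom.mk _ _ (weakCommRigOfCommSemiring _) (weakCommRigOfCommSemiring _)
    f.hom (map_zero f.hom) (map_one f.hom) (map_add f.hom) (map_mul f.hom)

/-! ### Localizations of fractional rigs -/

/-- A `*`-idempotent of a fractional rig: `e e = e` and `e* = e`. -/
def IsStarIdempotent {R : Type u} [FractionalRig R] (e : R) : Prop :=
  e * e = e ∧ fstar e = e

/-- `l : R ⟶ S` is universal among the maps out of `R` which send `e` to `1`. -/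
def IsLocalizationAt {R S : FWCRig.{u}} (l : R ⟶ S) (e : R.carrier) : Prop :=
  l.toFun e = 1 ∧ ∀ (T : FWCRig.{u}) (f : R ⟶ T), f.toFun e = 1 → ∃! k : S ⟶ T, l ≫ k = f

/-- The localizations of fractional rigs: the maps which are universal with respect to `e = 1`,
for some `*`-idempotent `e` of the domain. -/
def loc : MorphismProperty FWCRig.{u} := fun R _ l =>
  ∃ e : R.carrier, IsStarIdempotent e ∧ IsLocalizationAt l e

/-- The elements `r` of `R` with `r e = r`, that is, the multiples of the idempotent `e`. -/
def Corner {R : Type u} [FractionalRig R] {e : R} (_he : IsStarIdempotent e) : Type u :=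
  {r : R // r * e = r}

namespace Corner

variable {R : Type u} [FractionalRig R] {e : R} (he : IsStarIdempotent e)

instance : Zero (Corner he) := ⟨⟨0 * e, by rw [mul_assoc, he.1]⟩⟩

instance : Add (Corner he) := ⟨fun x y => ⟨x.1 + y.1, by rw [add_mul, x.2, y.2]⟩⟩

/-- The fractional rig of multiples of `e`, with unit `e` and zero `0 e`. -/
instance : FractionalRig (Corner he) where
  mul x y := ⟨x.1 * y.1, by rw [mul_assoc, y.2]⟩
  one := ⟨e, he.1⟩
  add_assoc x y z := Subtype.ext (add_assoc x.1 y.1 z.1)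
  add_comm x y := Subtype.ext (add_comm x.1 y.1)
  zero_add x := Subtype.ext (by
    change 0 * e + x.1 = x.1
    nth_rw 1 [← x.2]
    rw [← add_mul, zero_add, x.2])
  add_zero x := Subtype.ext (by
    change x.1 + 0 * e = x.1
    nth_rw 1 [← x.2]
    rw [← add_mul, add_zero, x.2])
  nsmul := nsmulRec
  mul_assoc x y z := Subtype.ext (mul_assoc x.1 y.1 z.1)
  mul_comm x y := Subtype.ext (mul_comm x.1 y.1)
  one_mul x := Subtype.ext ((mul_comm e x.1).trans x.2)
  mul_one x := Subtype.ext x.2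
  left_distrib x y z := Subtype.ext (mul_add x.1 y.1 z.1)
  right_distrib x y z := Subtype.ext (add_mul x.1 y.1 z.1)
  zero_mul_zero' := Subtype.ext (by
    change 0 * e * (0 * e) = 0 * e
    rw [mul_mul_mul_comm, he.1, WeakCommRig.zero_mul_zero'])
  zero_mul_sq' x := Subtype.ext (by
    calc 0 * e * x.1 = 0 * x.1 * e := mul_right_comm _ _ _
      _ = 0 * x.1 * x.1 * e := by rw [← WeakCommRig.zero_mul_sq']
      _ = 0 * e * x.1 * x.1 := by ac_rfl)
  fstar x := ⟨fstar x.1, by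
    conv_rhs => rw [← x.2, FractionalRig.fstar_mul, he.2]
    exact mul_comm _ _⟩
  fstar_one := Subtype.ext he.2
  fstar_fstar_fstar x := Subtype.ext (FractionalRig.fstar_fstar_fstar x.1)
  fstar_mul x y := Subtype.ext (FractionalRig.fstar_mul x.1 y.1)
  fstar_mul_self_mul_fstar x := Subtype.ext (FractionalRig.fstar_mul_self_mul_fstar x.1)
  fstar_mul_add x y z := Subtype.ext (FractionalRig.fstar_mul_add x.1 y.1 z.1)

end Corner

/-- The canonical localization `r ↦ r e`. -/
def toCorner {R : FWCRig.{u}} {e : R.carrier} (he : IsStarIdempotent e) :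
    R ⟶ (⟨Corner he⟩ : FWCRig.{u}) :=
  FractionalRigHom.mk
    (WeakRigHom.mk (S := Corner he) (fun r => ⟨r * e, by rw [mul_assoc, he.1]⟩) rfl
      (Subtype.ext (one_mul e)) (fun x y => Subtype.ext (add_mul x y e))
      (fun x y => Subtype.ext (by
        change x * y * e = x * e * (y * e)
        rw [mul_mul_mul_comm, he.1])))
    (fun x => Subtype.ext (by
      change fstar x * e = fstar (x * e)
      rw [FractionalRig.fstar_mul, he.2, mul_comm]))

theorem isLocalizationAt_toCorner {R : FWCRig.{u}} {e : R.carrier} (he : IsStarIdempotent e) :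
    IsLocalizationAt (toCorner he) e := by
  refine ⟨Subtype.ext he.1, fun T f hf => ⟨?_, ?_, ?_⟩⟩
  · exact FractionalRigHom.mk (R := Corner he) (WeakRigHom.mk (R := Corner he)
      (fun r => f.toFun r.1)
      (by change f.toFun (0 * e) = 0; rw [f.map_mul, hf, mul_one, f.map_zero])
      hf (fun x y => f.map_add x.1 y.1) (fun x y => f.map_mul x.1 y.1))
      (fun x => f.map_fstar x.1)
  · refine FWCRig.hom_ext (fun x => ?_)
    change f.toFun (x * e) = f.toFun x
    rw [f.map_mul, hf, mul_one]
  · rintro k rfl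
    refine FWCRig.hom_ext (fun x => ?_)
    change k.toFun x = k.toFun (⟨x.1 * e, _⟩ : Corner he)
    congr 1
    exact Subtype.ext x.2.symm

theorem IsLocalizationAt.epi {R S : FWCRig.{u}} {l : R ⟶ S} {e : R.carrier}
    (h : IsLocalizationAt l e) : Epi l := by
  refine ⟨fun {T} g k hgk => ?_⟩
  have he : (l ≫ k).toFun e = 1 := by rw [FWCRig.comp_toFun, h.1, k.map_one]
  exact (h.2 T (l ≫ k) he).unique hgk rfl

theorem IsLocalizationAt.surjective {R S : FWCRig.{u}} {l : R ⟶ S} {e : R.carrier}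
    (he : IsStarIdempotent e) (h : IsLocalizationAt l e) : Function.Surjective l.toFun := by
  have h' := isLocalizationAt_toCorner he
  obtain ⟨k, hk, -⟩ := h.2 _ _ h'.1
  obtain ⟨k', hk', -⟩ := h'.2 _ _ h.1
  have := h.epi
  have hid : k ≫ k' = 𝟙 S := by
    rw [← cancel_epi l, reassoc_of% hk, hk', Category.comp_id]
  intro s
  refine ⟨(show Corner he from k.toFun s).1, ?_⟩
  have h₁ : (toCorner he).toFun (show Corner he from k.toFun s).1 = k.toFun s :=
    Subtype.ext (show Corner he from k.toFun s).2
  rw [← hk', FWCRig.comp_toFun, h₁, ← FWCRig.comp_toFun, hid, FWCRig.id_toFun]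

theorem IsStarIdempotent.map {R S : FWCRig.{u}} (f : R ⟶ S) {e : R.carrier}
    (he : IsStarIdempotent e) : IsStarIdempotent (f.toFun e) :=
  ⟨by rw [← f.map_mul, he.1], by rw [← f.map_fstar, he.2]⟩

theorem IsStarIdempotent.mul {R : Type u} [FractionalRig R] {e e' : R}
    (he : IsStarIdempotent e) (he' : IsStarIdempotent e') : IsStarIdempotent (e * e') :=
  ⟨by rw [mul_mul_mul_comm, he.1, he'.1], by rw [FractionalRig.fstar_mul, he.2, he'.2, mul_comm]⟩

theorem isStarIdempotent_mul_fstar {R : Type u} [FractionalRig R] (x : R) :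
    IsStarIdempotent (x * fstar x) := by
  have h₁ := FractionalRig.fstar_mul_self_mul_fstar x
  have h₂ := FractionalRig.fstar_mul_self_mul_fstar (fstar (fstar x))
  rw [FractionalRig.fstar_fstar_fstar] at h₂
  refine ⟨by rw [mul_assoc, ← mul_assoc (fstar x), h₁], ?_⟩
  calc fstar (x * fstar x) = fstar (fstar x) * fstar x := FractionalRig.fstar_mul _ _
    _ = fstar (fstar x) * (fstar x * x * fstar x) := by rw [h₁]
    _ = x * (fstar x * fstar (fstar x) * fstar x) := by ac_rfl
    _ = x * fstar x := by rw [h₂]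

theorem loc_comp {R S T : FWCRig.{u}} (l : R ⟶ S) (l' : S ⟶ T) (hl : loc l) (hl' : loc l') :
    loc (l ≫ l') := by
  obtain ⟨e, he, h⟩ := hl
  obtain ⟨e', he', h'⟩ := hl'
  obtain ⟨r, rfl⟩ := h.surjective he e'
  have hr : l.toFun (r * fstar r) = l.toFun r := by
    rw [l.map_mul, l.map_fstar, he'.2, he'.1]
  have hi := (isStarIdempotent_mul_fstar r)
  refine ⟨r * fstar r * e, hi.mul he, ?_, fun K f hf => ?_⟩
  · rw [FWCRig.comp_toFun, l.map_mul, hr, h.1, mul_one, h'.1]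
  · have hfe : f.toFun e = 1 := by
      calc f.toFun e = f.toFun (r * fstar r * e) * f.toFun e := by rw [hf, one_mul]
        _ = f.toFun (r * fstar r * e) := by rw [← f.map_mul, mul_assoc, he.1]
        _ = 1 := hf
    have hfr : f.toFun (r * fstar r) = 1 := by
      rw [f.map_mul, hfe, mul_one] at hf; exact hf
    obtain ⟨k, hk, -⟩ := h.2 K f hfe
    have hk1 : k.toFun (l.toFun r) = 1 := by rw [← hr, ← FWCRig.comp_toFun, hk, hfr]
    obtain ⟨k', hk', -⟩ := h'.2 K k hk1
    have := h.epi
    have := h'.epi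
    refine ⟨k', by simp [hk', hk], fun g hg => ?_⟩
    rw [← cancel_epi l', hk', ← cancel_epi l, hk, ← hg, Category.assoc]

theorem loc_of_isIso {R S : FWCRig.{u}} (l : R ⟶ S) (hl : IsIso l) : loc l := by
  refine ⟨1, ⟨one_mul 1, FractionalRig.fstar_one⟩, l.map_one, fun T f _ => ?_⟩
  exact ⟨inv l ≫ f, by simp, fun g hg => by simp [← hg]⟩

theorem exists_pushout_loc {R S K : FWCRig.{u}} (l : R ⟶ S) (f : R ⟶ K) (hl : loc l) :
    ∃ (P : FWCRig.{u}) (g : S ⟶ P) (l' : K ⟶ P), IsPushout l f g l' ∧ loc l' := by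
  obtain ⟨e, he, h⟩ := hl
  have hfe := he.map f
  have h' := isLocalizationAt_toCorner hfe
  obtain ⟨g, hg, -⟩ := h.2 _ (f ≫ toCorner hfe) h'.1
  have := h.epi
  have := h'.epi
  have h1 : ∀ s : Limits.PushoutCocone l f, s.inr.toFun (f.toFun e) = 1 := fun s => by
    rw [← FWCRig.comp_toFun, ← s.condition, FWCRig.comp_toFun, h.1, s.inl.map_one]
  refine ⟨_, g, toCorner hfe, ⟨⟨hg⟩, ⟨Limits.PushoutCocone.IsColimit.mk hg
    (fun s => (h'.2 _ s.inr (h1 s)).choose) (fun s => ?_)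
    (fun s => (h'.2 _ s.inr (h1 s)).choose_spec.1)
    (fun s m _ hm => (h'.2 _ s.inr (h1 s)).choose_spec.2 m hm)⟩⟩, ⟨_, hfe, h'⟩⟩
  rw [← cancel_epi l, reassoc_of% hg, (h'.2 _ s.inr (h1 s)).choose_spec.1, s.condition]

/-- The localizations form a stable system of monics in the opposite of fractional rigs. -/
instance : PartialMaps.StableSystemOfMonics (loc.{u}).op where
  mono_of_mem m hm := by
    obtain ⟨e, -, h⟩ := hm
    have := h.epi
    exact inferInstanceAs (Mono m.unop.op)
  mem_of_isIso m hm := loc_of_isIso m.unop inferInstance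
  comp_mem m n hm hn := loc_comp n.unop m.unop hn hm
  exists_pullback m f hm := by
    obtain ⟨P, g, l', hP, hl'⟩ := exists_pushout_loc m.unop f.unop hm
    exact ⟨.op P, g.op, l'.op, hP.op.flip, hl'⟩

/-! ### Finitely generated localizations of commutative rigs and of commutative rings -/

/-- `φ` is universal among the maps of commutative rigs that send `U` to units. -/
def IsRigLocAt {R S : CommSemiRingCat.{u}} (φ : R ⟶ S) (U : Submonoid R) : Prop :=
  (∀ x ∈ U, IsUnit (φ.hom x)) ∧
    ∀ (T : CommSemiRingCat.{u}) (f : R ⟶ T), (∀ x ∈ U, IsUnit (f.hom x)) → ∃! k : S ⟶ T, φ ≫ k = f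

/-- The finitely generated localizations of commutative rigs: the homomorphisms that are universal
among those inverting some finitely generated multiplicative set. -/
def rigLoc : MorphismProperty CommSemiRingCat.{u} := fun R _ φ =>
  ∃ U : Submonoid R, U.FG ∧ IsRigLocAt φ U

/-- `φ` is universal among the maps of commutative rings that send `U` to units. -/
def IsRingLocAt {R S : CommRingCat.{u}} (φ : R ⟶ S) (U : Submonoid R) : Prop :=
  (∀ x ∈ U, IsUnit (φ.hom x)) ∧
    ∀ (T : CommRingCat.{u}) (f : R ⟶ T), (∀ x ∈ U, IsUnit (f.hom x)) → ∃! k : S ⟶ T, φ ≫ k = f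

/-- The finitely generated localizations of commutative rings: the homomorphisms that are universal
among those inverting some finitely generated multiplicative set. -/
def ringLoc : MorphismProperty CommRingCat.{u} := fun R _ φ =>
  ∃ U : Submonoid R, U.FG ∧ IsRingLocAt φ U

/-- Given a localization at `U` and one at `V` of the result, the composite inverts a finitely
generated multiplicative set. -/
theorem exists_fg_numerators {R S : Type u} [CommSemiring R] [CommSemiring S] (φ : R →+* S)
    (U : Submonoid R) (hU : U.FG) (hu : ∀ x ∈ U, IsUnit (φ x))
    (hs : ∀ s : S, ∃ x : R, ∃ y ∈ U, s * φ y = φ x) (V : Submonoid S) (hV : V.FG) :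
    ∃ U' : Submonoid R, U'.FG ∧ U ≤ U' ∧
      ∀ {T : Type u} [CommSemiring T] (k : S →+* T),
        (∀ x ∈ U', IsUnit (k (φ x))) ↔ ∀ v ∈ V, IsUnit (k v) := by
  classical
  choose n d hd h using hs
  obtain ⟨A, rfl⟩ := hU
  obtain ⟨B, rfl⟩ := hV
  refine ⟨Submonoid.closure (A ∪ B.image n : Finset R), ⟨_, rfl⟩,
    Submonoid.closure_mono (by simp), fun {T} _ k => ?_⟩
  have key : ∀ {M : Type u} [CommMonoid M] (C : Set M) (g : M →* T),
      (∀ x ∈ Submonoid.closure C, IsUnit (g x)) ↔ ∀ x ∈ C, IsUnit (g x) := by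
    intro M _ C g
    exact Submonoid.closure_le (S := (IsUnit.submonoid T).comap g)
  have hk : ∀ s : S, IsUnit (k (φ (n s))) ↔ IsUnit (k s) := by
    intro s
    rw [← h s, map_mul, IsUnit.mul_iff]
    exact ⟨fun h => h.1, fun h' => ⟨h', (hu _ (hd s)).map k⟩⟩
  have e₁ := key (A ∪ B.image n : Finset R) ((k.comp φ : R →+* T) : R →* T)
  have e₂ := key (B : Set S) (k : S →* T)
  refine e₁.trans (Iff.trans ?_ e₂.symm)
  constructor
  · intro h' v hv
    refine (hk v).1 (h' _ ?_)
    simp only [Finset.coe_union, Finset.coe_image]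
    exact Or.inr ⟨v, hv, rfl⟩
  · intro h' x hx
    simp only [Finset.coe_union, Finset.coe_image] at hx
    rcases hx with hx | ⟨v, hv, rfl⟩
    · exact (hu x (Submonoid.subset_closure hx)).map k
    · exact (hk v).2 (h' v hv)

/-- The universal property determines `S` up to isomorphism under `R`, so that every element of
`S` is a fraction. -/
theorem exists_fraction_of_iso {R S : Type u} [CommSemiring R] [CommSemiring S] (φ : R →+* S)
    (U : Submonoid R) (k : Localization U →+* S) (hk : k.comp (algebraMap R _) = φ)
    (hs : Function.Surjective k) (s : S) : ∃ x : R, ∃ y ∈ U, s * φ y = φ x := by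
  obtain ⟨z, rfl⟩ := hs s
  obtain ⟨⟨x, y⟩, h⟩ := IsLocalization.surj U z
  refine ⟨x, y.1, y.2, ?_⟩
  rw [← hk, RingHom.comp_apply, RingHom.comp_apply, ← map_mul, h]

theorem isRigLocAt_localization {R : CommSemiRingCat.{u}} (U : Submonoid R) :
    IsRigLocAt (CommSemiRingCat.ofHom (algebraMap R (Localization U))) U := by
  refine ⟨fun x hx => IsLocalization.map_units (Localization U) ⟨x, hx⟩, fun T f hf => ?_⟩
  refine ⟨CommSemiRingCat.ofHom (IsLocalization.lift (M := U) (S := Localization U)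
    (g := f.hom) (fun y => hf y.1 y.2)), ?_, fun k hk => ?_⟩
  · ext x
    simp
  · subst hk
    ext : 1
    refine IsLocalization.ringHom_ext U ?_
    ext x
    simp

theorem IsRigLocAt.epi {R S : CommSemiRingCat.{u}} {φ : R ⟶ S} {U : Submonoid R}
    (h : IsRigLocAt φ U) : Epi φ :=
  ⟨fun {T} _ k hgk => (h.2 T (φ ≫ k) (fun x hx => (h.1 x hx).map k.hom)).unique hgk rfl⟩

theorem IsRigLocAt.exists_fraction {R S : CommSemiRingCat.{u}} {φ : R ⟶ S} {U : Submonoid R}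
    (h : IsRigLocAt φ U) (s : S) : ∃ x : R, ∃ y ∈ U, s * φ.hom y = φ.hom x := by
  have h' := isRigLocAt_localization U
  obtain ⟨k, hk, -⟩ := h.2 _ _ h'.1
  obtain ⟨k', hk', -⟩ := h'.2 _ _ h.1
  have := h.epi
  have hid : k ≫ k' = 𝟙 S := by
    rw [← cancel_epi φ, reassoc_of% hk, hk', Category.comp_id]
  refine exists_fraction_of_iso φ.hom U k'.hom (congrArg CommSemiRingCat.Hom.hom hk') (fun s => ?_) s
  exact ⟨k.hom s, congrArg (fun f : S ⟶ S => f.hom s) hid⟩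

theorem rigLoc_comp {R S T : CommSemiRingCat.{u}} (l : R ⟶ S) (l' : S ⟶ T) (hl : rigLoc l)
    (hl' : rigLoc l') : rigLoc (l ≫ l') := by
  obtain ⟨U, hU, h⟩ := hl
  obtain ⟨V, hV, h'⟩ := hl'
  obtain ⟨U', hU', hle, hiff⟩ := exists_fg_numerators l.hom U hU h.1
    (IsRigLocAt.exists_fraction h) V hV
  have := IsRigLocAt.epi h
  have := IsRigLocAt.epi h'
  refine ⟨U', hU', (hiff l'.hom).2 h'.1, fun K f hf => ?_⟩
  obtain ⟨k, rfl, -⟩ := h.2 K f (fun x hx => hf x (hle hx))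
  obtain ⟨k', rfl, -⟩ := h'.2 K k ((hiff k.hom).1 hf)
  exact ⟨k', by simp, fun g hg => by simpa [cancel_epi] using hg⟩

theorem rigLoc_of_isIso {R S : CommSemiRingCat.{u}} (l : R ⟶ S) (hl : IsIso l) : rigLoc l := by
  refine ⟨⊥, ⟨∅, by simp⟩, fun x hx => ?_, fun T f _ => ?_⟩
  · rw [Submonoid.mem_bot.1 hx, map_one]; exact isUnit_one
  · exact ⟨inv l ≫ f, by simp, fun g hg => by simp [← hg]⟩

theorem exists_pushout_rigLoc {R S K : CommSemiRingCat.{u}} (l : R ⟶ S) (f : R ⟶ K)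
    (hl : rigLoc l) :
    ∃ (P : CommSemiRingCat.{u}) (g : S ⟶ P) (l' : K ⟶ P), IsPushout l f g l' ∧ rigLoc l' := by
  obtain ⟨U, hU, h⟩ := hl
  have h' := isRigLocAt_localization (U.map f.hom)
  set l' := CommSemiRingCat.ofHom (algebraMap K (Localization (U.map f.hom)))
  obtain ⟨g, hg, -⟩ := h.2 _ (f ≫ l') (fun x hx => h'.1 _ ⟨x, hx, rfl⟩)
  have := IsRigLocAt.epi h
  have := h'.epi
  have h1 : ∀ s : Limits.PushoutCocone l f, ∀ y ∈ U.map f.hom, IsUnit (s.inr.hom y) := by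
    rintro s _ ⟨x, hx, rfl⟩
    have e : s.inl.hom (l.hom x) = s.inr.hom (f.hom x) :=
      congrArg (fun f : R ⟶ s.pt => f.hom x) s.condition
    exact e ▸ (h.1 x hx).map s.inl.hom
  refine ⟨_, g, l', ⟨⟨hg⟩, ⟨Limits.PushoutCocone.IsColimit.mk hg
    (fun s => (h'.2 _ s.inr (h1 s)).choose) (fun s => ?_)
    (fun s => (h'.2 _ s.inr (h1 s)).choose_spec.1)
    (fun s m _ hm => (h'.2 _ s.inr (h1 s)).choose_spec.2 m hm)⟩⟩, ⟨_, hU.map _, h'⟩⟩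
  rw [← cancel_epi l, reassoc_of% hg, (h'.2 _ s.inr (h1 s)).choose_spec.1, s.condition]

/-- The finitely generated localizations form a stable system of monics in the opposite of
commutative rigs. -/
instance : PartialMaps.StableSystemOfMonics (rigLoc.{u}).op where
  mono_of_mem m hm := by
    obtain ⟨U, -, h⟩ := hm
    have := IsRigLocAt.epi h
    exact inferInstanceAs (Mono m.unop.op)
  mem_of_isIso m hm := rigLoc_of_isIso m.unop inferInstance
  comp_mem m n hm hn := rigLoc_comp n.unop m.unop hn hm
  exists_pullback m f hm := by
    obtain ⟨P, g, l', hP, hl'⟩ := exists_pushout_rigLoc m.unop f.unop hm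
    exact ⟨.op P, g.op, l'.op, hP.op.flip, hl'⟩

theorem isRingLocAt_localization {R : CommRingCat.{u}} (U : Submonoid R) :
    IsRingLocAt (CommRingCat.ofHom (algebraMap R (Localization U))) U := by
  refine ⟨fun x hx => IsLocalization.map_units (Localization U) ⟨x, hx⟩, fun T f hf => ?_⟩
  refine ⟨CommRingCat.ofHom (IsLocalization.lift (M := U) (S := Localization U)
    (g := f.hom) (fun y => hf y.1 y.2)), ?_, fun k hk => ?_⟩
  · ext x
    simp
  · subst hk
    ext : 1
    refine IsLocalization.ringHom_ext U ?_
    ext x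
    simp

theorem IsRingLocAt.epi {R S : CommRingCat.{u}} {φ : R ⟶ S} {U : Submonoid R}
    (h : IsRingLocAt φ U) : Epi φ :=
  ⟨fun {T} _ k hgk => (h.2 T (φ ≫ k) (fun x hx => (h.1 x hx).map k.hom)).unique hgk rfl⟩

theorem IsRingLocAt.exists_fraction {R S : CommRingCat.{u}} {φ : R ⟶ S} {U : Submonoid R}
    (h : IsRingLocAt φ U) (s : S) : ∃ x : R, ∃ y ∈ U, s * φ.hom y = φ.hom x := by
  have h' := isRingLocAt_localization U
  obtain ⟨k, hk, -⟩ := h.2 _ _ h'.1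
  obtain ⟨k', hk', -⟩ := h'.2 _ _ h.1
  have := h.epi
  have hid : k ≫ k' = 𝟙 S := by
    rw [← cancel_epi φ, reassoc_of% hk, hk', Category.comp_id]
  refine exists_fraction_of_iso φ.hom U k'.hom (congrArg CommRingCat.Hom.hom hk') (fun s => ?_) s
  exact ⟨k.hom s, congrArg (fun f : S ⟶ S => f.hom s) hid⟩

theorem ringLoc_comp {R S T : CommRingCat.{u}} (l : R ⟶ S) (l' : S ⟶ T) (hl : ringLoc l)
    (hl' : ringLoc l') : ringLoc (l ≫ l') := by
  obtain ⟨U, hU, h⟩ := hl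
  obtain ⟨V, hV, h'⟩ := hl'
  obtain ⟨U', hU', hle, hiff⟩ := exists_fg_numerators l.hom U hU h.1
    (IsRingLocAt.exists_fraction h) V hV
  have := IsRingLocAt.epi h
  have := IsRingLocAt.epi h'
  refine ⟨U', hU', (hiff l'.hom).2 h'.1, fun K f hf => ?_⟩
  obtain ⟨k, rfl, -⟩ := h.2 K f (fun x hx => hf x (hle hx))
  obtain ⟨k', rfl, -⟩ := h'.2 K k ((hiff k.hom).1 hf)
  exact ⟨k', by simp, fun g hg => by simpa [cancel_epi] using hg⟩

theorem ringLoc_of_isIso {R S : CommRingCat.{u}} (l : R ⟶ S) (hl : IsIso l) : ringLoc l := by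
  refine ⟨⊥, ⟨∅, by simp⟩, fun x hx => ?_, fun T f _ => ?_⟩
  · rw [Submonoid.mem_bot.1 hx, map_one]; exact isUnit_one
  · exact ⟨inv l ≫ f, by simp, fun g hg => by simp [← hg]⟩

theorem exists_pushout_ringLoc {R S K : CommRingCat.{u}} (l : R ⟶ S) (f : R ⟶ K)
    (hl : ringLoc l) :
    ∃ (P : CommRingCat.{u}) (g : S ⟶ P) (l' : K ⟶ P), IsPushout l f g l' ∧ ringLoc l' := by
  obtain ⟨U, hU, h⟩ := hl
  have h' := isRingLocAt_localization (U.map f.hom)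
  set l' := CommRingCat.ofHom (algebraMap K (Localization (U.map f.hom)))
  obtain ⟨g, hg, -⟩ := h.2 _ (f ≫ l') (fun x hx => h'.1 _ ⟨x, hx, rfl⟩)
  have := IsRingLocAt.epi h
  have := h'.epi
  have h1 : ∀ s : Limits.PushoutCocone l f, ∀ y ∈ U.map f.hom, IsUnit (s.inr.hom y) := by
    rintro s _ ⟨x, hx, rfl⟩
    have e : s.inl.hom (l.hom x) = s.inr.hom (f.hom x) :=
      congrArg (fun f : R ⟶ s.pt => f.hom x) s.condition
    exact e ▸ (h.1 x hx).map s.inl.hom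
  refine ⟨_, g, l', ⟨⟨hg⟩, ⟨Limits.PushoutCocone.IsColimit.mk hg
    (fun s => (h'.2 _ s.inr (h1 s)).choose) (fun s => ?_)
    (fun s => (h'.2 _ s.inr (h1 s)).choose_spec.1)
    (fun s m _ hm => (h'.2 _ s.inr (h1 s)).choose_spec.2 m hm)⟩⟩, ⟨_, hU.map _, h'⟩⟩
  rw [← cancel_epi l, reassoc_of% hg, (h'.2 _ s.inr (h1 s)).choose_spec.1, s.condition]

/-- The finitely generated localizations form a stable system of monics in the opposite of
commutative rings. -/
instance : PartialMaps.StableSystemOfMonics (ringLoc.{u}).op where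
  mono_of_mem m hm := by
    obtain ⟨U, -, h⟩ := hm
    have := IsRingLocAt.epi h
    exact inferInstanceAs (Mono m.unop.op)
  mem_of_isIso m hm := ringLoc_of_isIso m.unop inferInstance
  comp_mem m n hm hn := ringLoc_comp n.unop m.unop hn hm
  exists_pullback m f hm := by
    obtain ⟨P, g, l', hP, hl'⟩ := exists_pushout_ringLoc m.unop f.unop hm
    exact ⟨.op P, g.op, l'.op, hP.op.flip, hl'⟩

/-! ### The categories of rational functions -/

/-- The category of rational functions: partial maps in the opposite of fractional rigs with
respect to localizations. -/
abbrev RAT : Type (u + 1) := PartialMaps.Par (loc.{u}).op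

/-- Partial maps in the opposite of commutative rigs with respect to finitely generated
localizations. -/
abbrev RATrig : Type (u + 1) := PartialMaps.Par (rigLoc.{u}).op

/-- Partial maps in the opposite of commutative rings with respect to finitely generated
localizations. -/
abbrev RATring : Type (u + 1) := PartialMaps.Par (ringLoc.{u}).op

/-- The functor `R ↦ fr (W R)` on commutative rigs. -/
def frRig : CommSemiRingCat.{u} ⥤ FWCRig.{u} := W ⋙ fr

/-- The functor `R ↦ fr (W R)` on commutative rings. -/
def frRing : CommRingCat.{u} ⥤ FWCRig.{u} := forget₂ CommRingCat CommSemiRingCat ⋙ W ⋙ fr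

/-- The objects `fr (W R)` of `RAT`, for commutative rigs `R`. -/
def frRigObjects : ObjectProperty RAT.{u} :=
  .ofObj fun R : CommSemiRingCat.{u} => ⟨.op (frRig.obj R)⟩

/-- The objects `fr (W R)` of `RAT`, for commutative rings `R`. -/
def frRingObjects : ObjectProperty RAT.{u} :=
  .ofObj fun R : CommRingCat.{u} => ⟨.op (frRing.obj R)⟩

/-- The comparison functor, given by `R ↦ fr (W R)` on objects and on both legs of cospans. -/
noncomputable def rigComparison (h : PartialMaps.IsMFunctor frRig.{u}.op rigLoc.op loc.op) :
    RATrig.{u} ⥤ frRigObjects.{u}.FullSubcategory :=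
  frRigObjects.lift h.par fun R => ObjectProperty.ofObj_apply _ R.base.unop

/-- The comparison functor for commutative rings. -/
noncomputable def ringComparison (h : PartialMaps.IsMFunctor frRing.{u}.op ringLoc.op loc.op) :
    RATring.{u} ⥤ frRingObjects.{u}.FullSubcategory :=
  frRingObjects.lift h.par fun R => ObjectProperty.ofObj_apply _ R.base.unop

end Rational

/-! Passing to partial map categories is formal. If a fully faithful functor preserves the chosen
monics and the pullbacks along them, then the induced functor on spans is faithful, and it is full
as soon as every chosen monic into an object of its image comes, up to isomorphism, from a chosen
monic upstairs. Restrictions are preserved on representatives. The algebra therefore has to show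
three things about fractions: full faithfulness, preservation of localizations and of pushouts along
them, and liftability of localizations.

All three rest on the criterion `Frac.mk_eq_mk_iff`: over a commutative rig, `x / y = x' / y'`
exactly when each of `y`, `y'` divides a power of the other and `x y' = x' y` after multiplication
by a power of `y`. In other words, `y` and `y'` define the same localization and the two fractions
agree there.

Full faithfulness: the fractions `z` with `0 * z = 0` are exactly the copy of `R` given by `x ↦ x /
1`, so a homomorphism of fraction rigs restricts to this copy; it is determined there because `x / y
= (x / 1) (y / 1)*`.

Preservation: a finitely generated `U` contains an element `c` such that every member of `U` divides
a power of `c`. Inverting `U` then becomes localization at the `*`-idempotent `c / c`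
(`Frac.isLocalizationAt_map`). Pushouts follow since on both sides base change along `f` moves the
localizing data along `f`.

Lifting: every `*`-idempotent fraction has the form `c / c`, so every localization comes from
inverting the powers of `c`. Rings need no separate fraction calculus: they use the same description
of elements and of equality in a localization. -/

namespace PartialMaps

/-! ### Functors induced on partial map categories -/

/-- The induced functor of partial map categories preserves restrictions. -/
theorem IsMFunctor.par_map_restriction {C : Type u} [Category.{v} C] {D : Type u'}
    [Category.{v'} D] {G : C ⥤ D} {M : MorphismProperty C} {N : MorphismProperty D}
    [StableSystemOfMonics M] [StableSystemOfMonics N] (h : IsMFunctor G M N) {A B : Par M}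
    (f : A ⟶ B) : h.par.map (Par.restriction f) = Par.restriction (h.par.map f) := by
  obtain ⟨s, rfl⟩ := Quotient.exists_rep f
  rfl

/-- Equality of partial maps is witnessed by an isomorphism of apexes, so faithfulness of `G` alone
would not suffice: fullness is what lifts that isomorphism. -/
theorem IsMFunctor.par_faithful {C : Type u} [Category.{v} C] {D : Type u'} [Category.{v'} D]
    {G : C ⥤ D} {M : MorphismProperty C} {N : MorphismProperty D} [StableSystemOfMonics M]
    [StableSystemOfMonics N] (h : IsMFunctor G M N) [G.Full] [G.Faithful] : h.par.Faithful where
  map_injective {A B} f g hfg := by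
    obtain ⟨s, rfl⟩ := Quotient.exists_rep f
    obtain ⟨t, rfl⟩ := Quotient.exists_rep g
    obtain ⟨φ, h₁, h₂⟩ := Quotient.exact hfg
    refine PSpan.toPHom_eq (G.preimageIso φ) (G.map_injective ?_) (G.map_injective ?_)
    · simpa using h₁
    · simpa using h₂

/-- Fullness, when the monics into objects in the image of the functor come from monics. -/
theorem IsMFunctor.par_full {C : Type u} [Category.{v} C] {D : Type u'} [Category.{v'} D]
    {G : C ⥤ D} {M : MorphismProperty C} {N : MorphismProperty D} [StableSystemOfMonics M]
    [StableSystemOfMonics N] (h : IsMFunctor G M N) [G.Full]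
    (hlift : ∀ {A : C} {X : D} (n : X ⟶ G.obj A), N n →
      ∃ (A' : C) (m : A' ⟶ A) (φ : X ≅ G.obj A'), M m ∧ φ.hom ≫ G.map m = n) :
    h.par.Full where
  map_surjective {A B} f := by
    obtain ⟨s, rfl⟩ := Quotient.exists_rep f
    obtain ⟨A', m, φ, hm, hφ⟩ := hlift s.left s.mem
    refine ⟨PSpan.toPHom ⟨A', m, G.preimage (φ.inv ≫ s.right), hm⟩, ?_⟩
    exact PSpan.toPHom_eq φ.symm (by simp [← hφ]) (by simp)

end PartialMaps

namespace Rational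

open FractionalRig (fstar)

/-! ### Localizations of fractional rigs and pushouts -/

/-- A map sending `e` to `1` cannot distinguish `z` from `z * e`, hence is constant on the fibres of
`l` and factors through the surjection `l`. This reduces the universal property to an elementwise
check. -/
theorem isLocalizationAt_of_surjective {R S : FWCRig.{u}} (l : R ⟶ S) (e : R.carrier)
    (h1 : l.toFun e = 1) (hs : Function.Surjective l.toFun)
    (hk : ∀ z w, l.toFun z = l.toFun w → z * e = w * e) : IsLocalizationAt l e := by
  refine ⟨h1, fun T f hf => ?_⟩
  obtain ⟨g, hg⟩ := hs.hasRightInverse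
  -- The value of `f` does not depend on the preimage chosen by the section `g`, so `f ∘ g` inherits
  -- every operation from `f`.
  have key : ∀ z, f.toFun (g (l.toFun z)) = f.toFun z := fun z => by
    have := congrArg f.toFun (hk _ _ (hg (l.toFun z)))
    simpa only [f.map_mul, hf, mul_one] using this
  refine ⟨FractionalRigHom.mk (WeakRigHom.mk (fun s => f.toFun (g s)) ?_ ?_ ?_ ?_) ?_,
    FWCRig.hom_ext key, ?_⟩
  · rw [← l.map_zero, key, f.map_zero]
  · rw [← l.map_one, key, f.map_one]
  · intro x y
    obtain ⟨x, rfl⟩ := hs x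
    obtain ⟨y, rfl⟩ := hs y
    rw [← l.map_add, key, key, key, f.map_add]
  · intro x y
    obtain ⟨x, rfl⟩ := hs x
    obtain ⟨y, rfl⟩ := hs y
    rw [← l.map_mul, key, key, key, f.map_mul]
  · intro x
    obtain ⟨x, rfl⟩ := hs x
    change f.toFun (g _) = fstar (f.toFun (g _))
    rw [← l.map_fstar, key, key, f.map_fstar]
  · rintro k rfl
    exact FWCRig.hom_ext fun s => congrArg k.toFun (hg s).symm

/-- In any cocone the leg out of `K` sends `f e` to `1`, so it factors uniquely through `l'`;
compatibility with the leg out of `S` can be tested after the epimorphism `l`. -/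
theorem isPushout_of_isLocalizationAt {R S K P : FWCRig.{u}} {l : R ⟶ S} {f : R ⟶ K} {g : S ⟶ P}
    {l' : K ⟶ P} (hc : l ≫ g = f ≫ l') {e : R.carrier} (h : IsLocalizationAt l e)
    (h' : IsLocalizationAt l' (f.toFun e)) : IsPushout l f g l' := by
  have := h.epi
  have h1 : ∀ s : Limits.PushoutCocone l f, s.inr.toFun (f.toFun e) = 1 := fun s => by
    rw [← FWCRig.comp_toFun, ← s.condition, FWCRig.comp_toFun, h.1, s.inl.map_one]
  refine ⟨⟨hc⟩, ⟨Limits.PushoutCocone.IsColimit.mk hc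
    (fun s => (h'.2 _ s.inr (h1 s)).choose) (fun s => ?_)
    (fun s => (h'.2 _ s.inr (h1 s)).choose_spec.1)
    (fun s m _ hm => (h'.2 _ s.inr (h1 s)).choose_spec.2 m hm)⟩⟩
  rw [← cancel_epi l, reassoc_of% hc, (h'.2 _ s.inr (h1 s)).choose_spec.1, s.condition]

theorem IsLocalizationAt.exists_iso {R S S' : FWCRig.{u}} {l : R ⟶ S} {l' : R ⟶ S'}
    {e : R.carrier} (h : IsLocalizationAt l e) (h' : IsLocalizationAt l' e) :
    ∃ φ : S ≅ S', l ≫ φ.hom = l' := by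
  obtain ⟨k, hk, -⟩ := h.2 _ _ h'.1
  obtain ⟨k', hk', -⟩ := h'.2 _ _ h.1
  have := h.epi
  have := h'.epi
  exact ⟨⟨k, k', by rw [← cancel_epi l, reassoc_of% hk, hk', Category.comp_id],
    by rw [← cancel_epi l', reassoc_of% hk', hk, Category.comp_id]⟩, hk⟩

/-! ### Star-idempotent fractions -/

/-- A `*`-idempotent fraction has a representative with equal numerator and denominator. -/
theorem IsStarIdempotent.exists_mk_self {R : Type u} [WeakCommRig R] {e : Frac R}
    (he : IsStarIdempotent e) : ∃ c : R, e = Frac.mk c c := by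
  induction e using Frac.ind with | _ x y
  refine ⟨x * y, ?_⟩
  -- Since `e = e e*`, the fraction equals `x y² / (y · y x)`, and one factor `y` cancels to leave
  -- `x y / (x y)`.
  have h : Frac.mk x y = Frac.mk x y * fstar (Frac.mk x y) := by rw [he.2, he.1]
  rw [h, Frac.fstar_mk, Frac.mk_mul_mk]
  exact Frac.mk_eq_of_dvd y x (by ac_rfl) (by ac_rfl) (by ac_rfl)

theorem Frac.isStarIdempotent_mk_self {R : Type u} [WeakCommRig R] (c : R) :
    IsStarIdempotent (Frac.mk c c) := by
  have h : Frac.mk c c = Frac.mk c 1 * fstar (Frac.mk c 1) := by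
    rw [Frac.fstar_mk, Frac.mk_mul_mk]; simp
  rw [h]
  exact isStarIdempotent_mul_fstar _

/-! ### Fractions of commutative rigs -/

section CommSemiring

attribute [local instance] weakCommRigOfCommSemiring

variable {R S : Type u} [CommSemiring R] [CommSemiring S]

/-- These conditions hold for the generating relation and themselves define an equivalence relation.
The divisibilities between powers are what make the cross-multiplication condition symmetric and
transitive. -/
theorem Frac.mk_eq_mk_imp {p q : R × R} (h : Relation.EqvGen (FracRel R) p q) :
    (∃ n, p.2 ∣ q.2 ^ n) ∧ (∃ n, q.2 ∣ p.2 ^ n) ∧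
      ∃ n, p.2 ^ n * (p.1 * q.2) = p.2 ^ n * (q.1 * p.2) := by
  induction h with
  | rel p q h =>
    obtain ⟨r, a, s⟩ := h
    refine ⟨⟨1, a, ?_⟩, ⟨2, s, ?_⟩, ⟨0, ?_⟩⟩ <;> ring
  | refl p => exact ⟨⟨1, by simp⟩, ⟨1, by simp⟩, ⟨0, rfl⟩⟩
  | symm p q _ ih =>
    obtain ⟨⟨n, hn⟩, ⟨m, hm⟩, k, hk⟩ := ih
    refine ⟨⟨m, hm⟩, ⟨n, hn⟩, n * k, ?_⟩
    obtain ⟨t, ht⟩ := pow_dvd_pow_of_dvd hn k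
    rw [pow_mul, ht, mul_right_comm, mul_right_comm _ t, hk]
  | trans p q r _ _ ih ih' =>
    obtain ⟨⟨n, hn⟩, ⟨m, hm⟩, k, hk⟩ := ih
    obtain ⟨⟨n', hn'⟩, ⟨m', hm'⟩, k', hk'⟩ := ih'
    -- The exponent has three shares: `k` for the first equation, `m * k'` to supply `q.2 ^ k'` for
    -- the second, and a last `m` to supply the factor `q.2` needed to link the two cross products.
    refine ⟨⟨n' * n, hn.trans ?_⟩, ⟨m * m', hm'.trans ?_⟩, k + m * k' + m, ?_⟩
    · rw [pow_mul]; exact pow_dvd_pow_of_dvd hn' n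
    · rw [pow_mul]; exact pow_dvd_pow_of_dvd hm m'
    obtain ⟨t, ht⟩ := pow_dvd_pow_of_dvd hm k'
    obtain ⟨t', ht'⟩ := hm
    rw [pow_add, pow_add, pow_mul, ht, ht']
    calc p.2 ^ k * (q.2 ^ k' * t) * (q.2 * t') * (p.1 * r.2)
        = p.2 ^ k * (p.1 * q.2) * (q.2 ^ k' * t * t' * r.2) := by ring
      _ = q.2 ^ k' * (q.1 * r.2) * (p.2 ^ k * p.2 * t * t') := by rw [hk]; ring
      _ = _ := by rw [hk']; ring

theorem Frac.mk_mul_left_of_dvd {a x y : R} (h : a ∣ y) : mk (a * x) (a * y) = mk x y := by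
  obtain ⟨s, hs⟩ := h
  exact mk_eq_of_dvd a s rfl hs rfl

theorem Frac.mk_mul_left_of_dvd_pow {a x y : R} {n : ℕ} (h : a ∣ y ^ n) :
    mk (a * x) (a * y) = mk x y := by
  -- Powers of `y` may be inserted freely. After inserting `y ^ n` the denominator is divisible by
  -- `a`, so `a` cancels, and then `y ^ n` is removed again.
  have key : ∀ (m : ℕ) (z w : R), y ∣ w → mk (y ^ m * z) (y ^ m * w) = mk z w := by
    intro m z w hw
    induction m with
    | zero => simp
    | succ m ih =>
      rw [pow_succ', mul_assoc, mul_assoc, mk_mul_left_of_dvd (hw.mul_left _), ih]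
  rw [← key n (a * x) (a * y) (dvd_mul_left _ _), mul_left_comm, mul_left_comm (y ^ n),
    mk_mul_left_of_dvd (h.mul_right y), key n x y dvd_rfl]

/-- For the converse, expand the first fraction by `y ^ k * y'` and the second by `y ^ k * y`. Both
factors divide powers of the respective denominators, so the expansions are legitimate; the
denominators then coincide, and the numerators agree by the third condition. -/
theorem Frac.mk_eq_mk_iff {x y x' y' : R} :
    mk x y = mk x' y' ↔ (∃ n, y ∣ y' ^ n) ∧ (∃ n, y' ∣ y ^ n) ∧
      ∃ n, y ^ n * (x * y') = y ^ n * (x' * y) := by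
  refine ⟨fun h => mk_eq_mk_imp (Quot.eqvGen_exact h), ?_⟩
  rintro ⟨⟨n, hn⟩, ⟨m, hm⟩, k, hk⟩
  have h₁ : y ^ k * y' ∣ y ^ (k + m) := by
    rw [pow_add]; exact mul_dvd_mul_left _ hm
  have h₂ : y ^ k * y ∣ y' ^ (n * (k + 1)) := by
    rw [← pow_succ, pow_mul]; exact pow_dvd_pow_of_dvd hn _
  rw [← mk_mul_left_of_dvd_pow h₁, ← mk_mul_left_of_dvd_pow h₂]
  congr 1
  · rw [mul_assoc, mul_comm y', hk]; ring
  · ring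

theorem Frac.mk_one_injective {x x' : R} (h : mk x 1 = mk x' 1) : x = x' := by
  obtain ⟨-, -, n, hn⟩ := mk_eq_mk_iff.1 h
  simpa using hn

/-- As `0 * (x / y) = 0 / y`, equality with `0 / 1` forces `y` to divide a power of `1`, so `y` is a
unit. The condition is equational, hence preserved by homomorphisms, which makes the copy of `R`
inside its fractions intrinsic. -/
theorem Frac.exists_mk_one {z : Frac R} (h : 0 * z = 0) : ∃ x : R, z = mk x 1 := by
  induction z using Frac.ind with | _ x y
  obtain ⟨⟨n, hn⟩, -, -⟩ := mk_eq_mk_iff.1 (show mk (0 * x) (1 * y) = mk 0 1 from h)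
  obtain ⟨t, ht⟩ : y ∣ 1 := by simpa using hn
  refine ⟨x * t, mk_eq_mk_iff.2 ⟨⟨1, by simp [ht]⟩, ⟨1, by simp⟩, 0, ?_⟩⟩
  rw [mul_assoc x t, mul_comm t, ← ht]

/-! ### Homomorphisms between rigs of fractions -/

/-- The map of weak commutative rigs underlying a homomorphism of commutative rigs. -/
def weakRigHom (φ : R →+* S) : WeakRigHom R S :=
  ⟨φ, map_zero φ, map_one φ, map_add φ, map_mul φ⟩

theorem Frac.map_injective {φ ψ : R →+* S} (h : map (weakRigHom φ) = map (weakRigHom ψ)) :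
    φ = ψ := by
  ext x
  have := congrArg (fun f : FractionalRigHom (Frac R) (Frac S) => f.toFun (mk x 1)) h
  simp only [map_mk] at this
  have h₁ : ∀ φ : R →+* S, (weakRigHom φ).toFun 1 = 1 := fun φ => _root_.map_one φ
  rw [h₁, h₁] at this
  exact mk_one_injective this

theorem Frac.exists_map_eq (g : FractionalRigHom (Frac R) (Frac S)) :
    ∃ φ : R →+* S, map (weakRigHom φ) = g := by
  have h : ∀ x, ∃ s, g.toFun (mk x 1) = mk s 1 := fun x => exists_mk_one (by
    rw [← g.map_zero, ← g.map_mul, zero_def, mk_mul_mk]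
    simp)
  choose φ hφ using h
  have hmul : ∀ x y, φ (x * y) = φ x * φ y := fun x y => mk_one_injective (by
    have := g.map_mul (mk x 1) (mk y 1)
    simpa only [mk_mul_mk, mul_one, hφ] using this)
  have hadd : ∀ x y, φ (x + y) = φ x + φ y := fun x y => mk_one_injective (by
    have := g.map_add (mk x 1) (mk y 1)
    simpa only [mk_add_mk, mul_one, one_mul, hφ] using this)
  refine ⟨⟨⟨⟨φ, mk_one_injective ?_⟩, hmul⟩, mk_one_injective ?_, hadd⟩, ?_⟩
  · rw [← hφ]; exact g.map_one
  · rw [← hφ]; exact g.map_zero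
  refine FWCRig.hom_ext (R := ⟨Frac R⟩) (S := ⟨Frac S⟩) (Frac.ind fun x y => ?_)
  -- The fractions with denominator `1` generate everything under product and star, so agreement on
  -- them is enough.
  have hxy : ∀ {T : Type u} [CommSemiring T] (x y : T), mk x y = mk x 1 * fstar (mk y 1) := by
    intro T _ x y
    rw [fstar_mk, mk_mul_mk]; simp
  change mk (φ x) (φ y) = g.toFun (mk x y)
  rw [hxy x y, g.map_mul, g.map_fstar, hφ, hφ, ← hxy]

/-! ### Finitely generated localizations and fractions -/

/-- In a finitely generated submonoid there is an element of whose powers all elements are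
divisors. -/
theorem exists_forall_dvd_pow_of_fg {U : Submonoid R} (hU : U.FG) :
    ∃ c ∈ U, ∀ u ∈ U, ∃ n, u ∣ c ^ n := by
  obtain ⟨A, rfl⟩ := hU
  refine ⟨∏ a ∈ A, a, prod_mem fun a ha => Submonoid.subset_closure ha, fun u hu => ?_⟩
  induction hu using Submonoid.closure_induction with
  | mem x hx => exact ⟨1, by simpa using Finset.dvd_prod_of_mem (fun a => a) hx⟩
  | one => exact ⟨0, by simp⟩
  | mul x y _ _ hx hy =>
    obtain ⟨n, hn⟩ := hx
    obtain ⟨m, hm⟩ := hy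
    exact ⟨n + m, by rw [pow_add]; exact mul_dvd_mul hn hm⟩

/-- Only the elementary description of a localization enters: units, fractions, and equality up to a
factor in `U`. Any such factor divides a power of `c`, and powers of `c` are available in the
denominator once a fraction has been multiplied by `c / c`. -/
theorem Frac.isLocalizationAt_map (φ : R →+* S) {U : Submonoid R}
    (hu : ∀ x ∈ U, IsUnit (φ x)) (hs : ∀ s : S, ∃ x : R, ∃ y ∈ U, s * φ y = φ x)
    (hk : ∀ x y : R, φ x = φ y → ∃ u ∈ U, u * x = u * y)
    {c : R} (hc : c ∈ U) (hcU : ∀ u ∈ U, ∃ n, u ∣ c ^ n) :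
    IsLocalizationAt (R := ⟨Frac R⟩) (S := ⟨Frac S⟩) (map (weakRigHom φ)) (mk c c) := by
  refine isLocalizationAt_of_surjective (R := ⟨Frac R⟩) (S := ⟨Frac S⟩) _ _ ?_ ?_ ?_
  · change mk (φ c) (φ c) = mk 1 1
    have := mk_mul_left_of_dvd (x := 1) (y := 1) (hu c hc).dvd
    simpa using this
  · refine Frac.ind fun s t => ?_
    obtain ⟨x, u, hx, hxu⟩ := hs s
    obtain ⟨y, v, hy, hyv⟩ := hs t
    -- With `s = x / u` and `t = y / v` in `S`, this fraction maps to `s / t` expanded by the unit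
    -- `φ (u * v)`, which cancels because a unit divides every denominator.
    refine ⟨mk (v * x) (u * y), ?_⟩
    change mk (φ (v * x)) (φ (u * y)) = mk s t
    have : φ (u * v) ∣ t := (hu _ (U.mul_mem hx hy)).dvd
    rw [← mk_mul_left_of_dvd this]
    simp only [map_mul, ← hxu, ← hyv]
    congr 1 <;> ring
  -- Divisibility in `S` descends to `R`: write the cofactor as `a / u`, clear denominators at the
  -- cost of some `v ∈ U`, and absorb `v * u` into a power of `c`.
  · have hdvd : ∀ {y y' : R} {n : ℕ}, φ y ∣ φ y' ^ n → ∃ n, y * c ∣ (y' * c) ^ n := by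
      rintro y y' n ⟨s, h⟩
      obtain ⟨a, u, hu', ha⟩ := hs s
      obtain ⟨v, hv, e⟩ := hk (y * a) (y' ^ n * u) (by
        rw [map_mul, ← ha, map_mul, map_pow, h, mul_assoc])
      obtain ⟨k, t, hk⟩ := hcU _ (U.mul_mem hv hu')
      refine ⟨n + k + 1, v * a * t * c ^ n * y' ^ (k + 1), ?_⟩
      calc (y' * c) ^ (n + k + 1) = y' ^ n * c ^ k * (c ^ n * c * y' ^ (k + 1)) := by ring
        _ = v * (y' ^ n * u) * t * (c ^ n * c * y' ^ (k + 1)) := by rw [hk]; ring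
        _ = _ := by rw [← e]; ring
    refine Frac.ind fun x y => Frac.ind fun x' y' h => ?_
    obtain ⟨⟨n, hn⟩, ⟨m, hm⟩, k, h⟩ := mk_eq_mk_iff.1
      (show mk (φ x) (φ y) = mk (φ x') (φ y') from h)
    change mk (x * c) (y * c) = mk (x' * c) (y' * c)
    obtain ⟨u, hu', e⟩ := hk (y ^ k * (x * y')) (y ^ k * (x' * y)) (by simpa using h)
    obtain ⟨j, t, hj⟩ := hcU u hu'
    -- The share `k` comes from the equation in `S`; the share `j` supplies `c ^ j`, a multiple of
    -- the `u` that lifts this equation to `R`.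
    refine mk_eq_mk_iff.2 ⟨hdvd hn, hdvd hm, k + j, ?_⟩
    calc (y * c) ^ (k + j) * (x * c * (y' * c))
        = c ^ j * (y ^ k * (x * y')) * (y ^ j * c ^ k * c * c) := by ring
      _ = u * (y ^ k * (x * y')) * t * (y ^ j * c ^ k * c * c) := by rw [hj]; ring
      _ = c ^ j * (y ^ k * (x' * y)) * (y ^ j * c ^ k * c * c) := by rw [e, hj]; ring
      _ = _ := by ring

end CommSemiring

/-! ### The functors from commutative rigs and from commutative rings -/

/-- The universal property gives a map from `S` to the concrete `Localization U` under `R`, so an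
equality in `S` can be read there. -/
theorem IsRigLocAt.exists_of_eq {R S : CommSemiRingCat.{u}} {φ : R ⟶ S} {U : Submonoid R}
    (h : IsRigLocAt φ U) (x y : R) (hxy : φ.hom x = φ.hom y) : ∃ u ∈ U, u * x = u * y := by
  have h' := isRigLocAt_localization U
  obtain ⟨k, hk, -⟩ := h.2 _ _ h'.1
  have e : algebraMap R (Localization U) x = algebraMap R (Localization U) y := by
    change (CommSemiRingCat.ofHom (algebraMap R (Localization U))).hom x =
      (CommSemiRingCat.ofHom (algebraMap R (Localization U))).hom y
    rw [← hk, CommSemiRingCat.comp_apply, CommSemiRingCat.comp_apply, hxy]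
  obtain ⟨u, hu⟩ := (IsLocalization.eq_iff_exists U _).1 e
  exact ⟨u, u.2, hu⟩

theorem IsRingLocAt.exists_of_eq {R S : CommRingCat.{u}} {φ : R ⟶ S} {U : Submonoid R}
    (h : IsRingLocAt φ U) (x y : R) (hxy : φ.hom x = φ.hom y) : ∃ u ∈ U, u * x = u * y := by
  have h' := isRingLocAt_localization U
  obtain ⟨k, hk, -⟩ := h.2 _ _ h'.1
  have e : algebraMap R (Localization U) x = algebraMap R (Localization U) y := by
    change (CommRingCat.ofHom (algebraMap R (Localization U))).hom x =
      (CommRingCat.ofHom (algebraMap R (Localization U))).hom y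
    rw [← hk, CommRingCat.comp_apply, CommRingCat.comp_apply, hxy]
  obtain ⟨u, hu⟩ := (IsLocalization.eq_iff_exists U _).1 e
  exact ⟨u, u.2, hu⟩

/-- A map `k` out of `K` inverting the image of `U` makes `f ≫ k` extend over `S`, and the two maps
glue on the pushout. Preservation of pushouts needs this for an arbitrary pushout square. -/
theorem IsRigLocAt.of_isPushout {R S K P : CommSemiRingCat.{u}} {l : R ⟶ S} {f : R ⟶ K}
    {g : S ⟶ P} {l' : K ⟶ P} (hP : IsPushout l f g l') {U : Submonoid R} (h : IsRigLocAt l U) :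
    IsRigLocAt l' (U.map f.hom) := by
  have hw : ∀ x, l'.hom (f.hom x) = g.hom (l.hom x) := fun x =>
    congrArg (fun f : R ⟶ P => f.hom x) hP.w.symm
  have := h.epi
  refine ⟨?_, fun T k hk => ?_⟩
  · rintro _ ⟨x, hx, rfl⟩
    exact (hw x) ▸ (h.1 x hx).map g.hom
  · obtain ⟨j, hj, -⟩ := h.2 T (f ≫ k) fun x hx => hk _ ⟨x, hx, rfl⟩
    refine ⟨hP.desc j k hj, hP.inr_desc _ _ _, fun q hq => hP.hom_ext ?_ ?_⟩
    · rw [hP.inl_desc, ← cancel_epi l, hP.w_assoc, hq, hj]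
    · rw [hP.inr_desc, hq]

theorem IsRingLocAt.of_isPushout {R S K P : CommRingCat.{u}} {l : R ⟶ S} {f : R ⟶ K}
    {g : S ⟶ P} {l' : K ⟶ P} (hP : IsPushout l f g l') {U : Submonoid R} (h : IsRingLocAt l U) :
    IsRingLocAt l' (U.map f.hom) := by
  have hw : ∀ x, l'.hom (f.hom x) = g.hom (l.hom x) := fun x =>
    congrArg (fun f : R ⟶ P => f.hom x) hP.w.symm
  have := h.epi
  refine ⟨?_, fun T k hk => ?_⟩
  · rintro _ ⟨x, hx, rfl⟩
    exact (hw x) ▸ (h.1 x hx).map g.hom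
  · obtain ⟨j, hj, -⟩ := h.2 T (f ≫ k) fun x hx => hk _ ⟨x, hx, rfl⟩
    refine ⟨hP.desc j k hj, hP.inr_desc _ _ _, fun q hq => hP.hom_ext ?_ ?_⟩
    · rw [hP.inl_desc, ← cancel_epi l, hP.w_assoc, hq, hj]
    · rw [hP.inr_desc, hq]

/-- The fraction `c / c` in `fr (W R)`. -/
def fracSelf {R : CommSemiRingCat.{u}} (c : R) : (frRig.obj R).carrier :=
  Frac.mk (R := (W.obj R).carrier) c c

theorem isStarIdempotent_fracSelf {R : CommSemiRingCat.{u}} (c : R) :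
    IsStarIdempotent (fracSelf c) :=
  Frac.isStarIdempotent_mk_self (R := (W.obj R).carrier) c

theorem IsRigLocAt.isLocalizationAt_map {R S : CommSemiRingCat.{u}} {φ : R ⟶ S} {U : Submonoid R}
    (h : IsRigLocAt φ U) {c : R} (hc : c ∈ U) (hcU : ∀ u ∈ U, ∃ n, u ∣ c ^ n) :
    IsLocalizationAt (frRig.map φ) (fracSelf c) :=
  Frac.isLocalizationAt_map φ.hom h.1 h.exists_fraction h.exists_of_eq hc hcU

theorem IsRingLocAt.isLocalizationAt_map {R S : CommRingCat.{u}} {φ : R ⟶ S} {U : Submonoid R}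
    (h : IsRingLocAt φ U) {c : R} (hc : c ∈ U) (hcU : ∀ u ∈ U, ∃ n, u ∣ c ^ n) :
    IsLocalizationAt (frRing.map φ)
      (fracSelf (R := (forget₂ CommRingCat CommSemiRingCat).obj R) c) :=
  Frac.isLocalizationAt_map φ.hom h.1 h.exists_fraction h.exists_of_eq hc hcU

theorem forall_map_dvd_pow {R S : Type u} [CommSemiring R] [CommSemiring S] (f : R →+* S)
    {U : Submonoid R} {c : R} (hcU : ∀ u ∈ U, ∃ n, u ∣ c ^ n) :
    ∀ u ∈ U.map f, ∃ n, u ∣ f c ^ n := by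
  rintro _ ⟨u, hu, rfl⟩
  obtain ⟨n, hn⟩ := hcU u hu
  exact ⟨n, by rw [← map_pow]; exact map_dvd f hn⟩

theorem isMFunctor_frRig : PartialMaps.IsMFunctor frRig.{u}.op rigLoc.op loc.op where
  map_mem m hm := by
    obtain ⟨U, hU, h⟩ := hm
    obtain ⟨c, hc, hcU⟩ := exists_forall_dvd_pow_of_fg hU
    exact ⟨fracSelf c, isStarIdempotent_fracSelf c, h.isLocalizationAt_map hc hcU⟩
  map_isPullback f' m' m f hm hP := by
    obtain ⟨U, hU, h⟩ := hm
    obtain ⟨c, hc, hcU⟩ := exists_forall_dvd_pow_of_fg hU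
    have hw : m.unop ≫ f'.unop = f.unop ≫ m'.unop := congrArg Quiver.Hom.unop hP.w
    have h' := IsRigLocAt.of_isPushout hP.unop.flip h
    refine (isPushout_of_isLocalizationAt (l := frRig.map m.unop) (f := frRig.map f.unop)
      (g := frRig.map f'.unop) (l' := frRig.map m'.unop) ?_ (h.isLocalizationAt_map hc hcU)
      -- The element `f c` plays for the image of `U` the role of `c` for `U`, so the opposite leg
      -- is a localization at the image of `c / c`, as the pushout criterion requires.
      (h'.isLocalizationAt_map ⟨c, hc, rfl⟩ (forall_map_dvd_pow f.unop.hom hcU))).op.flip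
    rw [← Functor.map_comp, hw, Functor.map_comp]

theorem isMFunctor_frRing : PartialMaps.IsMFunctor frRing.{u}.op ringLoc.op loc.op where
  map_mem m hm := by
    obtain ⟨U, hU, h⟩ := hm
    obtain ⟨c, hc, hcU⟩ := exists_forall_dvd_pow_of_fg hU
    exact ⟨_, isStarIdempotent_fracSelf _, h.isLocalizationAt_map hc hcU⟩
  map_isPullback f' m' m f hm hP := by
    obtain ⟨U, hU, h⟩ := hm
    obtain ⟨c, hc, hcU⟩ := exists_forall_dvd_pow_of_fg hU
    have hw : m.unop ≫ f'.unop = f.unop ≫ m'.unop := congrArg Quiver.Hom.unop hP.w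
    have h' := IsRingLocAt.of_isPushout hP.unop.flip h
    refine (isPushout_of_isLocalizationAt (l := frRing.map m.unop) (f := frRing.map f.unop)
      (g := frRing.map f'.unop) (l' := frRing.map m'.unop) ?_ (h.isLocalizationAt_map hc hcU)
      (h'.isLocalizationAt_map ⟨c, hc, rfl⟩ (forall_map_dvd_pow f.unop.hom hcU))).op.flip
    rw [← Functor.map_comp, hw, Functor.map_comp]

/-! ### Full faithfulness of the functors of fractions -/

instance : frRig.{u}.Faithful where
  map_injective h := CommSemiRingCat.hom_ext (Frac.map_injective h)

instance : frRig.{u}.Full where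
  map_surjective {A B} g := by
    obtain ⟨φ, h⟩ := Frac.exists_map_eq (R := A) (S := B) g
    exact ⟨CommSemiRingCat.ofHom φ, h⟩

instance : frRing.{u}.Faithful where
  map_injective h := CommRingCat.hom_ext (Frac.map_injective h)

instance : frRing.{u}.Full where
  map_surjective {A B} g := by
    obtain ⟨φ, h⟩ := Frac.exists_map_eq (R := A) (S := B) g
    exact ⟨CommRingCat.ofHom φ, h⟩

/-! ### Lifting localizations of fractional rigs -/

theorem powers_fg {R : Type u} [CommSemiring R] (c : R) : (Submonoid.powers c).FG :=
  ⟨{c}, by simp [Submonoid.powers_eq_closure]⟩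

theorem forall_powers_dvd_pow {R : Type u} [CommSemiring R] (c : R) :
    ∀ u ∈ Submonoid.powers c, ∃ n, u ∣ c ^ n := by
  rintro _ ⟨n, rfl⟩
  exact ⟨n, dvd_rfl⟩

/-- The localizing idempotent is some `c / c`, and inverting the powers of `c` yields another
localization at the same idempotent; two such are isomorphic under the domain. This is the input for
fullness. -/
theorem exists_lift_of_rigLoc {A : CommSemiRingCat.{u}ᵒᵖ} {X : FWCRig.{u}ᵒᵖ}
    (n : X ⟶ frRig.op.obj A) (hn : loc.op n) :
    ∃ (A' : CommSemiRingCat.{u}ᵒᵖ) (m : A' ⟶ A) (φ : X ≅ frRig.op.obj A'),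
      rigLoc.op m ∧ φ.hom ≫ frRig.op.map m = n := by
  obtain ⟨e, he, h⟩ := hn
  obtain ⟨c, rfl⟩ := IsStarIdempotent.exists_mk_self (R := (W.obj A.unop).carrier) he
  have h' := isRigLocAt_localization (R := A.unop) (Submonoid.powers (c : A.unop))
  obtain ⟨φ, hφ⟩ := (h'.isLocalizationAt_map (Submonoid.mem_powers _)
    (forall_powers_dvd_pow _)).exists_iso h
  exact ⟨_, Quiver.Hom.op _, φ.op, ⟨_, powers_fg _, h'⟩, congrArg Quiver.Hom.op hφ⟩

theorem exists_lift_of_ringLoc {A : CommRingCat.{u}ᵒᵖ} {X : FWCRig.{u}ᵒᵖ}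
    (n : X ⟶ frRing.op.obj A) (hn : loc.op n) :
    ∃ (A' : CommRingCat.{u}ᵒᵖ) (m : A' ⟶ A) (φ : X ≅ frRing.op.obj A'),
      ringLoc.op m ∧ φ.hom ≫ frRing.op.map m = n := by
  obtain ⟨e, he, h⟩ := hn
  obtain ⟨c, rfl⟩ := IsStarIdempotent.exists_mk_self
    (R := (W.obj ((forget₂ CommRingCat CommSemiRingCat).obj A.unop)).carrier) he
  have h' := isRingLocAt_localization (R := A.unop) (Submonoid.powers (c : A.unop))
  obtain ⟨φ, hφ⟩ := (h'.isLocalizationAt_map (Submonoid.mem_powers _)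
    (forall_powers_dvd_pow _)).exists_iso h
  exact ⟨_, Quiver.Hom.op _, φ.op, ⟨_, powers_fg _, h'⟩, congrArg Quiver.Hom.op hφ⟩

/-! ### The equivalences -/

theorem rigComparison_isEquivalence : (rigComparison isMFunctor_frRig.{u}).IsEquivalence := by
  have h₁ : isMFunctor_frRig.{u}.par.Faithful := isMFunctor_frRig.par_faithful
  have h₂ : isMFunctor_frRig.{u}.par.Full := isMFunctor_frRig.par_full exists_lift_of_rigLoc
  refine @Functor.IsEquivalence.mk _ _ _ _ _ ?_ ?_ ⟨?_⟩
  -- Followed by the fully faithful inclusion, the comparison is the induced functor, so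
  -- faithfulness and fullness can be read off from the latter.
  · exact Functor.Faithful.of_comp_iso (ObjectProperty.liftCompιIso frRigObjects _ _)
  · exact Functor.Full.of_comp_faithful_iso (ObjectProperty.liftCompιIso frRigObjects _ _)
  · rintro ⟨_, ⟨R⟩⟩
    exact ⟨⟨.op R⟩, ⟨Iso.refl _⟩⟩

theorem ringComparison_isEquivalence : (ringComparison isMFunctor_frRing.{u}).IsEquivalence := by
  have h₁ : isMFunctor_frRing.{u}.par.Faithful := isMFunctor_frRing.par_faithful
  have h₂ : isMFunctor_frRing.{u}.par.Full := isMFunctor_frRing.par_full exists_lift_of_ringLoc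
  refine @Functor.IsEquivalence.mk _ _ _ _ _ ?_ ?_ ⟨?_⟩
  · exact Functor.Faithful.of_comp_iso (ObjectProperty.liftCompιIso frRingObjects _ _)
  · exact Functor.Full.of_comp_faithful_iso (ObjectProperty.liftCompιIso frRingObjects _ _)
  · rintro ⟨_, ⟨R⟩⟩
    exact ⟨⟨.op R⟩, ⟨Iso.refl _⟩⟩

end Rational
theorem mainTheorem5 :
    (∃ h : PartialMaps.IsMFunctor Rational.frRig.{u}.op Rational.rigLoc.{u}.op Rational.loc.{u}.op,
      (Rational.rigComparison.{u} h).IsEquivalence ∧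
      ∀ (A B : Rational.RATrig.{u}) (f : A ⟶ B),
        ((Rational.rigComparison.{u} h).map (PartialMaps.Par.restriction f)).hom =
          PartialMaps.Par.restriction ((Rational.rigComparison.{u} h).map f).hom) ∧
    (∃ h : PartialMaps.IsMFunctor Rational.frRing.{u}.op Rational.ringLoc.{u}.op
        Rational.loc.{u}.op,
      (Rational.ringComparison.{u} h).IsEquivalence ∧
      ∀ (A B : Rational.RATring.{u}) (f : A ⟶ B),
        ((Rational.ringComparison.{u} h).map (PartialMaps.Par.restriction f)).hom =
          PartialMaps.Par.restriction ((Rational.ringComparison.{u} h).map f).hom) :=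
  ⟨⟨Rational.isMFunctor_frRig, Rational.rigComparison_isEquivalence,
      fun _ _ f => Rational.isMFunctor_frRig.par_map_restriction f⟩,
    ⟨Rational.isMFunctor_frRing, Rational.ringComparison_isEquivalence,
      fun _ _ f => Rational.isMFunctor_frRing.par_map_restriction f⟩⟩
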